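/- For integers $n \ge r \ge 1$ let $[n]^{(r)}$ be the family of all $r$-element subsets of $[n]=\{1,\dots,n\}$, and let $K(n,r)$ be the Kneser graph: its vertex set is $[n]^{(r)}$, and $A,B$ are adjacent if and only if $A\cap B=\emptyset$. For $p\in[0,1]$ let $K_p(n,r)$ be the random subgraph of $K(n,r)$ on the same vertex set obtained by retaining each edge of $K(n,r)$ independently with probability $p$. Write $\alpha(G)$ for the largest size of an independent set of a graph $G$, call $\{A\in[n]^{(r)} : x\in A\}$ the star centred at $x\in[n]$, and set $$p_c(n,r)=\frac{(r+1)\log n-r\log r}{\binom{n-1}{r-1}}.$$ Fix a real number $\varepsilon>0$, let $r=r(n)$ be natural numbers with $r(n)\ge 2$ for all sufficiently large $n$ and $r(n)=o(n^{1/3})$ as $n\to\infty$, and let $p=p(n)\in[0,1]$. 1. If $p(n)\ge(1+\varepsilon)\,p_c(n,r)$ for all sufficiently large $n$, then, as $n\to\infty$, $$\mathbb P\Big(\alpha(K_p(n,r))=\tbinom{n-1}{r-1}\Big)\to 1,$$ and, with probability tending to $1$, the independent sets of size $\binom{n-1}{r-1}$ in $K_p(n,r)$ are exactly the stars. 2.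 If $p(n)\le(1-\varepsilon)\,p_c(n,r)$ for all sufficiently large $n$, then, as $n\to\infty$, $$\mathbb P\Big(\alpha(K_p(n,r))=\tbinom{n-1}{r-1}\Big)\to 0.$$ -/

import Mathlib

open MeasureTheory ProbabilityTheory Filter Topology Asymptotics

/-- The `r`-element subsets of an `n`-element ground set. -/
abbrev RSet (n r : ℕ) : Type := {A : Finset (Fin n) // A.card = r}

/-- The Kneser graph `K(n, r)`: two (distinct) `r`-sets are adjacent iff they are disjoint.
Distinctness is automatic when `1 ≤ r`. -/
def kneserGraph (n r : ℕ) : SimpleGraph (RSet n r) where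
  Adj A B := A ≠ B ∧ Disjoint A.1 B.1
  symm := ⟨fun _ _ h => ⟨h.1.symm, h.2.symm⟩⟩
  loopless := ⟨fun _ h => h.1 rfl⟩

/-- The star centred at `x`: all the `r`-sets containing `x`. -/
def kneserStar (n r : ℕ) (x : Fin n) : Finset (RSet n r) :=
  Finset.univ.filter fun A => x ∈ A.1

/-- The law of the random subgraph of `G` that retains each edge of `G` independently with
probability `p`. -/
noncomputable def randomSubgraph {V : Type*} (G : SimpleGraph V) (p : unitInterval) :
    Measure (SimpleGraph V) :=
  (setBernoulli G.edgeSet p).map SimpleGraph.fromEdgeSet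

instance {V : Type*} [Countable V] (G : SimpleGraph V) (p : unitInterval) :
    IsProbabilityMeasure (randomSubgraph G p) :=
  Measure.isProbabilityMeasure_map SimpleGraph.measurable_fromEdgeSet.aemeasurable

/-- The law of `K_p(n, r)`. -/
noncomputable def randomKneser (n r : ℕ) (p : unitInterval) : Measure (SimpleGraph (RSet n r)) :=
  randomSubgraph (kneserGraph n r) p

instance (n r : ℕ) (p : unitInterval) : IsProbabilityMeasure (randomKneser n r p) :=
  inferInstanceAs (IsProbabilityMeasure (randomSubgraph _ _))

/-- The threshold `p_c(n, r) = ((r + 1) log n - r log r) / C(n - 1, r - 1)`. -/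
noncomputable def pCrit (n r : ℕ) : ℝ :=
  (((r : ℝ) + 1) * Real.log n - r * Real.log r) / ((n - 1).choose (r - 1) : ℝ)

/-! Write `V = C(n-1, r-1)` for the size of a star, `W = C(n-2, r-2)` for the overlap of two stars,
`N = C(n, r)` and `L` for the numerator of `pCrit`. A star stops being maximal when some outside set
`A` has no retained edge to it. This has probability about `exp(-p V)`, and there are about `n N ≈
exp L` pairs of a centre and an outside set, so the change occurs at `p V ≈ L`.

Below the threshold the expected number of such pairs tends to infinity. Two of these events share
at most `W` edges, and `p W → 0`, so they are almost pairwise independent and the second moment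
method produces an independent set larger than a star (`randomKneser_real_indepNum_eq_le`).

Above the threshold, let `F` be an independent set of size `V` that is not a star, let `x` maximise
its degree, and let `i` be the number of members of `F` avoiding `x`. A small `δ` depending on `ε`
separates two cases.

If `i ≥ δ V`, stars overlap so little that the squared degrees of `F` sum to about `V (V - i)` at
most. Hence `F` spans at least `5/12 * i V` Kneser edges
(`card_sdiff_kneserStar_mul_le_card_kneserEdges`), all of which must be deleted. A union bound
weighted by `(r/n) ^ i` excludes this (`randomKneser_real_exists_far_le`).

If `i ≤ δ V`, the retained neighbours in the star of the `i` outside members all lie among the `i`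
missing members of the star. So a small outside family has no more neighbours in the star than it
has members. The dominant obstruction is a single set, and a union bound shows that none occurs
(`randomKneser_real_exists_near_le`). -/

/-! ### Edge events in a random subgraph -/

instance SimpleGraph.instDiscreteMeasurableSpace {V : Type*} [Finite V] :
    DiscreteMeasurableSpace (SimpleGraph V) := by
  have : MeasurableSingletonClass (SimpleGraph V) := by
    refine ⟨fun G => ?_⟩
    have h := SimpleGraph.measurable_edgeSet (V := V) (measurableSet_singleton G.edgeSet)
    convert h using 1
    ext H
    simp
  infer_instance

/-- The event is a cylinder of the product measure on `ι → Prop`, so its probability factors over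
the coordinates in `P ∪ Q`. -/
theorem setBernoulli_real_subset_disjoint {ι : Type*} [Countable ι] {u : Set ι} (p : unitInterval)
    {P Q : Finset ι} (hP : ↑P ⊆ u) (hQ : ↑Q ⊆ u) (hPQ : Disjoint P Q) :
    (setBernoulli u p).real {s | ↑P ⊆ s ∧ ∀ e ∈ Q, e ∉ s} =
      (p : ℝ) ^ P.card * (1 - p : ℝ) ^ Q.card := by
  classical
  have key : (fun f : ι → Prop => {i | f i}) ⁻¹' {s | ↑P ⊆ s ∧ ∀ e ∈ Q, e ∉ s} =
      Set.pi ↑(P ∪ Q) (fun i => if i ∈ P then {True} else {False}) := by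
    ext f
    simp only [Set.mem_preimage, Set.mem_ofPred_eq, Set.mem_pi, Finset.coe_union, Set.mem_union,
      Finset.mem_coe]
    constructor
    · rintro ⟨h1, h2⟩ i hi
      split_ifs with hiP
      · simpa using h1 hiP
      · simpa using h2 i (hi.resolve_left hiP)
    · intro h
      refine ⟨fun i hi => ?_, fun i hi => ?_⟩
      · have := h i (Or.inl hi)
        simpa [Finset.mem_coe.1 hi] using this
      · have := h i (Or.inr hi)
        have hi' : i ∉ P := fun h' => Finset.disjoint_left.1 hPQ h' hi
        simpa [hi'] using this
  rw [measureReal_def, setBernoulli_apply', key, Measure.infinitePi_pi, Finset.prod_union hPQ]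
  · rw [ENNReal.toReal_mul, ENNReal.toReal_prod, ENNReal.toReal_prod]
    congr 1
    · rw [Finset.prod_congr rfl (g := fun _ => (p : ℝ)), Finset.prod_const]
      intro i hi
      have := hP hi
      simp [hi, this]
    · rw [Finset.prod_congr rfl (g := fun _ => (1 - p : ℝ)), Finset.prod_const]
      intro i hi
      have h1 := hQ hi
      have hi' : i ∉ P := fun h' => Finset.disjoint_left.1 hPQ h' hi
      simp [hi', h1]
  · intro i _
    exact MeasurableSet.of_discrete

section
variable {V : Type*} [Finite V] (G : SimpleGraph V) (p : unitInterval)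

theorem randomSubgraph_ae_le : ∀ᵐ H ∂(randomSubgraph G p), H ≤ G := by
  rw [randomSubgraph, ae_map_iff SimpleGraph.measurable_fromEdgeSet.aemeasurable
    MeasurableSet.of_discrete]
  filter_upwards [setBernoulli_ae_subset] with s hs
  rw [← SimpleGraph.edgeSet_subset_edgeSet, SimpleGraph.edgeSet_fromEdgeSet]
  exact Set.sdiff_subset.trans hs

theorem randomSubgraph_real_eq {P Q : Finset (Sym2 V)} (hP : ↑P ⊆ G.edgeSet) (hQ : ↑Q ⊆ G.edgeSet)
    (hPQ : Disjoint P Q) :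
    (randomSubgraph G p).real {H | ↑P ⊆ H.edgeSet ∧ ∀ e ∈ Q, e ∉ H.edgeSet} =
      (p : ℝ) ^ P.card * (1 - p : ℝ) ^ Q.card := by
  rw [randomSubgraph, map_measureReal_apply SimpleGraph.measurable_fromEdgeSet
    MeasurableSet.of_discrete, ← setBernoulli_real_subset_disjoint p hP hQ hPQ]
  congr 1
  ext s
  simp only [Set.mem_preimage, Set.mem_ofPred_eq, SimpleGraph.edgeSet_fromEdgeSet]
  have hd : ∀ e ∈ G.edgeSet, ¬ e.IsDiag := fun e he => G.not_isDiag_of_mem_edgeSet he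
  constructor
  · rintro ⟨h1, h2⟩
    exact ⟨fun e he => (h1 he).1, fun e he hs => h2 e he ⟨hs, hd e (hQ he)⟩⟩
  · rintro ⟨h1, h2⟩
    exact ⟨fun e he => ⟨h1 he, hd e (hP he)⟩, fun e he hs => h2 e he hs.1⟩

/-- If `P` contains a non-edge of `G` the event is null. The upper bound therefore survives for the
arbitrary witness functions used later, whose pairs need not be Kneser edges. -/
theorem randomSubgraph_real_le {P Q : Finset (Sym2 V)} (hQ : ↑Q ⊆ G.edgeSet)
    (hPQ : Disjoint P Q) :
    (randomSubgraph G p).real {H | ↑P ⊆ H.edgeSet ∧ ∀ e ∈ Q, e ∉ H.edgeSet} ≤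
      (p : ℝ) ^ P.card * (1 - p : ℝ) ^ Q.card := by
  by_cases hP : ↑P ⊆ G.edgeSet
  · exact (randomSubgraph_real_eq G p hP hQ hPQ).le
  · have h0 : (randomSubgraph G p).real {H | ↑P ⊆ H.edgeSet ∧ ∀ e ∈ Q, e ∉ H.edgeSet} = 0 := by
      rw [measureReal_eq_zero_iff]
      refine measure_mono_null ?_ (randomSubgraph_ae_le G p)
      intro H hH hle
      exact hP (hH.1.trans (SimpleGraph.edgeSet_subset_edgeSet.2 hle))
    rw [h0]
    have := p.2.1
    have := p.2.2
    have : (0 : ℝ) ≤ 1 - p := by linarith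
    positivity

theorem randomSubgraph_real_forall_notMem {Q : Finset (Sym2 V)} (hQ : ↑Q ⊆ G.edgeSet) :
    (randomSubgraph G p).real {H | ∀ e ∈ Q, e ∉ H.edgeSet} = (1 - p : ℝ) ^ Q.card := by
  have := randomSubgraph_real_eq G p (P := ∅) (by simp) hQ (by simp)
  simpa using this

end

/-! ### Second moment method -/

/-- A second moment bound for the probability that none of finitely many pairwise almost
independent events occurs. -/
theorem measureReal_forall_notMem_le {Ω J : Type*} [MeasurableSpace Ω] [Fintype J] (μ : Measure Ω)
    [IsProbabilityMeasure μ] (E : J → Set Ω) (hE : ∀ i, MeasurableSet (E i)) {C : ℝ} (hC : 0 ≤ C)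
    (hpair : ∀ i j, i ≠ j → μ.real (E i ∩ E j) ≤ C * (μ.real (E i) * μ.real (E j)))
    (hpos : 0 < ∑ i, μ.real (E i)) :
    μ.real {ω | ∀ i, ω ∉ E i} ≤ (∑ i, μ.real (E i))⁻¹ + (C - 1) := by
  classical
  set m := ∑ i, μ.real (E i) with hm
  let X : Ω → ℝ := fun ω => ∑ i, (E i).indicator 1 ω
  have hint : ∀ s : Set Ω, MeasurableSet s → Integrable (s.indicator (1 : Ω → ℝ)) μ :=
    fun s hs => (integrable_const (1 : ℝ)).indicator hs
  have hX2 : ∀ ω, (X ω - m) ^ 2 =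
      ∑ i, ∑ j, (E i ∩ E j).indicator 1 ω - 2 * m * ∑ i, (E i).indicator 1 ω + m ^ 2 := by
    intro ω
    have : X ω ^ 2 = ∑ i, ∑ j, (E i ∩ E j).indicator (1 : Ω → ℝ) ω := by
      rw [sq, Finset.sum_mul_sum]
      refine Finset.sum_congr rfl fun i _ => Finset.sum_congr rfl fun j _ => ?_
      rw [Set.inter_indicator_one]
      rfl
    rw [← this]
    ring
  have hi2 : Integrable (fun ω => ∑ i, ∑ j, (E i ∩ E j).indicator (1 : Ω → ℝ) ω) μ :=
    integrable_finsetSum _ fun i _ => integrable_finsetSum _ fun j _ =>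
      hint _ ((hE i).inter (hE j))
  have hi1 : Integrable (fun ω => ∑ i, (E i).indicator (1 : Ω → ℝ) ω) μ :=
    integrable_finsetSum _ fun i _ => hint _ (hE i)
  have hi3 : Integrable (fun ω => ∑ i, ∑ j, (E i ∩ E j).indicator (1 : Ω → ℝ) ω -
      2 * m * ∑ i, (E i).indicator (1 : Ω → ℝ) ω) μ := hi2.sub (hi1.const_mul _)
  have hsum : ∫ ω, (X ω - m) ^ 2 ∂μ = ∑ i, ∑ j, μ.real (E i ∩ E j) - m ^ 2 := by
    simp_rw [hX2]
    rw [integral_add hi3 (integrable_const _),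
      integral_sub hi2 (hi1.const_mul _), integral_const_mul,
      integral_finsetSum _ (fun i _ => integrable_finsetSum _ fun j _ =>
        hint _ ((hE i).inter (hE j))), integral_finsetSum _ (fun i _ => hint _ (hE i))]
    simp_rw [integral_finsetSum _ (fun j _ => hint _ ((hE _).inter (hE j)))]
    simp_rw [fun i j => integral_indicator_one (μ := μ) ((hE i).inter (hE j)),
      fun i => integral_indicator_one (μ := μ) (hE i)]
    rw [← hm]
    simp
    ring
  -- The diagonal contributes at most `m` beyond the almost independent part `C * m ^ 2`.
  have hub : ∑ i, ∑ j, μ.real (E i ∩ E j) ≤ m + C * m ^ 2 := by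
    have : ∀ i j, μ.real (E i ∩ E j) ≤
        (if i = j then μ.real (E i) else 0) + C * (μ.real (E i) * μ.real (E j)) := by
      intro i j
      by_cases h : i = j
      · subst h
        simp only [Set.inter_self, if_true]
        have : 0 ≤ C * (μ.real (E i) * μ.real (E i)) := by positivity
        linarith
      · simpa [h] using hpair i j h
    calc _ ≤ ∑ i, ∑ j, ((if i = j then μ.real (E i) else 0) + C * (μ.real (E i) * μ.real (E j))) :=
          Finset.sum_le_sum fun i _ => Finset.sum_le_sum fun j _ => this i j
      _ = m + C * m ^ 2 := by
          simp only [Finset.sum_add_distrib, Finset.sum_ite_eq, Finset.mem_univ, if_true,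
            ← Finset.mul_sum]
          rw [← hm, ← Finset.sum_mul, ← hm, sq]
  -- Chebyshev: where no event occurs, `X = 0` and the integrand is `m ^ 2`.
  have hlow : m ^ 2 * μ.real {ω | ∀ i, ω ∉ E i} ≤ ∫ ω, (X ω - m) ^ 2 ∂μ := by
    have hmeas : MeasurableSet {ω | ∀ i, ω ∉ E i} := by
      have : {ω | ∀ i, ω ∉ E i} = ⋂ i, (E i)ᶜ := by ext; simp
      rw [this]
      exact MeasurableSet.iInter fun i => (hE i).compl
    have hI : Integrable (fun ω => (X ω - m) ^ 2) μ := by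
      simp_rw [hX2]
      exact hi3.add (integrable_const _)
    rw [← integral_indicator_one hmeas, ← integral_const_mul]
    refine integral_mono ((hint _ hmeas).const_mul _) hI fun ω => ?_
    by_cases h : ω ∈ {ω | ∀ i, ω ∉ E i}
    · have : X ω = 0 := Finset.sum_eq_zero fun i _ => by simp [h i]
      simp [h, this]
    · simp only [Set.indicator_of_notMem h, mul_zero]
      positivity
  have h1 : m ^ 2 * μ.real {ω | ∀ i, ω ∉ E i} ≤ m + C * m ^ 2 - m ^ 2 := by linarith
  have h2 : m ^ 2 * (m⁻¹ + (C - 1)) = m + C * m ^ 2 - m ^ 2 := by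
    field_simp
    ring
  rw [← h2] at h1
  exact le_of_mul_le_mul_left h1 (by positivity)

/-! ### Stars, their intersections and degrees -/

@[simp] theorem mem_kneserStar {n r : ℕ} {x : Fin n} {A : RSet n r} :
    A ∈ kneserStar n r x ↔ x ∈ A.1 := by
  simp [kneserStar]

theorem card_RSet (n r : ℕ) : Fintype.card (RSet n r) = n.choose r := by
  simp [RSet]

theorem card_filter_subset_RSet {n r : ℕ} {D : Finset (Fin n)} (hD : D.card ≤ r) :
    (Finset.univ.filter fun A : RSet n r => D ⊆ A.1).card = (n - D.card).choose (r - D.card) := by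
  have h : (Finset.powersetCard (r - D.card) Dᶜ).card = (n - D.card).choose (r - D.card) := by
    rw [Finset.card_powersetCard, Finset.card_compl, Fintype.card_fin]
  rw [← h]
  refine Finset.card_bij (fun A _ => A.1 \ D) ?_ ?_ ?_
  · intro A hA
    simp only [Finset.mem_filter, Finset.mem_univ, true_and] at hA
    rw [Finset.mem_powersetCard, Finset.card_sdiff_of_subset hA, A.2]
    exact ⟨fun a ha => by simp_all, rfl⟩
  · intro A hA B hB hAB
    simp only [Finset.mem_filter, Finset.mem_univ, true_and] at hA hB
    ext1
    rw [← Finset.sdiff_union_of_subset hA, ← Finset.sdiff_union_of_subset hB, hAB]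
  · intro B hB
    rw [Finset.mem_powersetCard] at hB
    have hdisj : Disjoint B D := by
      rw [Finset.disjoint_left]
      intro a ha
      simpa using hB.1 ha
    refine ⟨⟨B ∪ D, ?_⟩, ?_, ?_⟩
    · rw [Finset.card_union_of_disjoint hdisj, hB.2]
      omega
    · simp
    · simp [Finset.union_sdiff_right, Finset.sdiff_eq_self_of_disjoint hdisj]

theorem card_kneserStar {n r : ℕ} (hr : 1 ≤ r) (x : Fin n) :
    (kneserStar n r x).card = (n - 1).choose (r - 1) := by
  rw [← Finset.card_singleton x, ← card_filter_subset_RSet (by simpa using hr)]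
  congr 1
  ext A
  simp

theorem card_inter_kneserStar {n r : ℕ} (hr : 2 ≤ r) {x y : Fin n} (hxy : x ≠ y) :
    (kneserStar n r x ∩ kneserStar n r y).card = (n - 2).choose (r - 2) := by
  rw [← Finset.card_pair hxy, ← card_filter_subset_RSet (by rw [Finset.card_pair hxy]; exact hr)]
  congr 1
  ext A
  simp [Finset.insert_subset_iff]

/-- An `r`-set avoiding `x` is disjoint from all but at most `r * C(n - 2, r - 2)` members of the
star centred at `x`. -/
theorem choose_sub_le_card_filter_disjoint {n r : ℕ} (hr : 2 ≤ r) {x : Fin n} {A : RSet n r}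
    (hA : x ∉ A.1) :
    (n - 1).choose (r - 1) ≤
      ((kneserStar n r x).filter fun B => Disjoint A.1 B.1).card + r * (n - 2).choose (r - 2) := by
  classical
  rw [← card_kneserStar (by omega : 1 ≤ r) x]
  have hsub : kneserStar n r x ⊆ ((kneserStar n r x).filter fun B => Disjoint A.1 B.1) ∪
      A.1.biUnion fun a => kneserStar n r x ∩ kneserStar n r a := by
    intro B hB
    by_cases h : Disjoint A.1 B.1
    · exact Finset.mem_union_left _ (Finset.mem_filter.2 ⟨hB, h⟩)
    · obtain ⟨a, ha, hb⟩ := Finset.not_disjoint_iff.1 h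
      refine Finset.mem_union_right _ (Finset.mem_biUnion.2 ⟨a, ha, ?_⟩)
      exact Finset.mem_inter.2 ⟨hB, mem_kneserStar.2 hb⟩
  refine (Finset.card_le_card hsub).trans ((Finset.card_union_le _ _).trans ?_)
  gcongr
  refine Finset.card_biUnion_le.trans ?_
  rw [Finset.sum_congr rfl fun a ha => card_inter_kneserStar hr (x := x) (y := a)
    (by rintro rfl; exact hA ha), Finset.sum_const, A.2, smul_eq_mul]

/-- A Bonferroni bound: `k ≤ 1 + k (k - 1)` for `k = #(K ∩ A)`, and each ordered pair of distinct
centres lies in at most `C(n-2, r-2)` members of `F`. -/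
theorem sum_card_inter_kneserStar_le {n r : ℕ} (hr : 2 ≤ r) (F : Finset (RSet n r))
    (K : Finset (Fin n)) :
    ∑ x ∈ K, (F ∩ kneserStar n r x).card ≤ F.card + K.card ^ 2 * (n - 2).choose (r - 2) := by
  classical
  have h1 : ∑ x ∈ K, (F ∩ kneserStar n r x).card = ∑ A ∈ F, (K ∩ A.1).card := by
    have := Finset.sum_card_bipartiteAbove_eq_sum_card_bipartiteBelow
      (s := K) (t := F) (fun (x : Fin n) (A : RSet n r) => x ∈ A.1)
    convert this using 2 with x hx A hA
    · congr 1
      ext A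
      simp [Finset.bipartiteAbove]
    · congr 1
  have h2 : ∑ e ∈ K.offDiag, (F ∩ (kneserStar n r e.1 ∩ kneserStar n r e.2)).card =
      ∑ A ∈ F, (K ∩ A.1).offDiag.card := by
    have := Finset.sum_card_bipartiteAbove_eq_sum_card_bipartiteBelow
      (s := K.offDiag) (t := F) (fun (x : Fin n × Fin n) (A : RSet n r) => x.1 ∈ A.1 ∧ x.2 ∈ A.1)
    convert this using 2 with x hx A hA
    · congr 1
      ext A
      simp [Finset.bipartiteAbove]
    · congr 1
      ext a
      simp only [Finset.mem_offDiag, Finset.mem_inter, Finset.bipartiteBelow, Finset.mem_filter]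
      tauto
  have h3 : ∀ A ∈ F, (K ∩ A.1).card ≤ 1 + (K ∩ A.1).offDiag.card := by
    intro A _
    rw [Finset.offDiag_card]
    rcases Nat.lt_or_ge (K ∩ A.1).card 2 with h | h
    · omega
    · have : 2 * (K ∩ A.1).card ≤ (K ∩ A.1).card * (K ∩ A.1).card := Nat.mul_le_mul_right _ h
      omega
  calc _ = ∑ A ∈ F, (K ∩ A.1).card := h1
    _ ≤ ∑ A ∈ F, (1 + (K ∩ A.1).offDiag.card) := Finset.sum_le_sum h3
    _ = F.card + ∑ e ∈ K.offDiag, (F ∩ (kneserStar n r e.1 ∩ kneserStar n r e.2)).card := by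
        rw [Finset.sum_add_distrib, h2]
        simp
    _ ≤ F.card + ∑ e ∈ K.offDiag, (n - 2).choose (r - 2) := by
        gcongr with e he
        rw [← card_inter_kneserStar hr (Finset.mem_offDiag.1 he).2.2]
        exact Finset.card_le_card Finset.inter_subset_right
    _ ≤ _ := by
        rw [Finset.sum_const, smul_eq_mul, Finset.offDiag_card, sq]
        gcongr
        omega

theorem sum_univ_card_inter_kneserStar {n r : ℕ} (F : Finset (RSet n r)) :
    ∑ x, (F ∩ kneserStar n r x).card = r * F.card := by
  classical
  have := Finset.sum_card_bipartiteAbove_eq_sum_card_bipartiteBelow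
      (s := Finset.univ) (t := F) (fun (x : Fin n) (A : RSet n r) => x ∈ A.1)
  calc _ = ∑ x : Fin n, (Finset.bipartiteAbove (fun (x : Fin n) (A : RSet n r) => x ∈ A.1) F x).card := by
        refine Finset.sum_congr rfl fun x _ => ?_
        congr 1
        ext A
        simp [Finset.bipartiteAbove]
    _ = ∑ A ∈ F, r := by
        rw [this]
        refine Finset.sum_congr rfl fun A _ => ?_
        simp [Finset.bipartiteBelow, A.2]
    _ = _ := by simp [mul_comm]

/-- The degrees of a family of `r`-sets have a small second moment: few points can have large
degree, because two stars have a small intersection. -/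
theorem sum_sq_card_inter_kneserStar_le {n r k m : ℕ} (hr : 2 ≤ r) (hk : 0 < k)
    (F : Finset (RSet n r)) (hm : ∀ x, (F ∩ kneserStar n r x).card ≤ m) :
    ∑ x, ((F ∩ kneserStar n r x).card : ℝ) ^ 2 ≤
      (F.card + k ^ 2 * (n - 2).choose (r - 2) : ℝ) * (m + r * F.card / k) := by
  classical
  set h : ℝ := F.card + k ^ 2 * (n - 2).choose (r - 2) with hh
  set d : Fin n → ℝ := fun x => ((F ∩ kneserStar n r x).card : ℝ) with hd
  have hkR : (0 : ℝ) < k := by exact_mod_cast hk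
  have hh0 : 0 ≤ h := by positivity
  -- The heavy points. Any `k` of them would have degree sum above `h`, against `hsum`, so at most
  -- `k` exist. Light points satisfy `d x ^ 2 ≤ h / k * d x`, and the degrees sum to `r * #F`.
  set H : Finset (Fin n) := Finset.univ.filter fun x => h / k < d x with hH
  have hsum : ∀ K : Finset (Fin n), K.card ≤ k → ∑ x ∈ K, d x ≤ h := by
    intro K hK
    have h1 : ∑ x ∈ K, d x ≤ F.card + (K.card : ℝ) ^ 2 * (n - 2).choose (r - 2) := by
      have := sum_card_inter_kneserStar_le hr F K
      rw [hd]
      beta_reduce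
      exact_mod_cast this
    refine h1.trans ?_
    rw [hh]
    gcongr
  have hHk : H.card ≤ k := by
    by_contra! hlt
    obtain ⟨K, hKH, hK⟩ := Finset.exists_subset_card_eq hlt.le
    have h1 := hsum K hK.le
    have hne : K.Nonempty := by
      rw [← Finset.card_pos, hK]
      exact hk
    have h2 : ∑ x ∈ K, h / k < ∑ x ∈ K, d x :=
      Finset.sum_lt_sum_of_nonempty hne fun x hx => (Finset.mem_filter.1 (hKH hx)).2
    rw [Finset.sum_const, hK, nsmul_eq_mul, mul_div_cancel₀ _ hkR.ne'] at h2
    linarith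
  have hd0 : ∀ x, 0 ≤ d x := fun x => by positivity
  have hheavy : ∑ x ∈ H, d x ^ 2 ≤ h * m := by
    calc ∑ x ∈ H, d x ^ 2 ≤ ∑ x ∈ H, d x * m := by
          refine Finset.sum_le_sum fun x _ => ?_
          rw [sq]
          have : d x ≤ m := Nat.cast_le.2 (hm x)
          exact mul_le_mul_of_nonneg_left this (hd0 x)
      _ ≤ h * m := by
          rw [← Finset.sum_mul]
          exact mul_le_mul_of_nonneg_right (hsum H hHk) (by positivity)
  have hlight : ∑ x ∈ Hᶜ, d x ^ 2 ≤ h / k * (r * F.card) := by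
    calc ∑ x ∈ Hᶜ, d x ^ 2 ≤ ∑ x ∈ Hᶜ, h / k * d x := by
          refine Finset.sum_le_sum fun x hx => ?_
          have : d x ≤ h / k := by simpa [hH] using hx
          rw [sq]
          exact mul_le_mul_of_nonneg_right this (hd0 x)
      _ ≤ ∑ x, h / k * d x :=
          Finset.sum_le_sum_of_subset_of_nonneg (Finset.subset_univ _)
            fun x _ _ => mul_nonneg (by positivity) (hd0 x)
      _ = h / k * (r * F.card) := by
          rw [← Finset.mul_sum]
          congr 1
          have := sum_univ_card_inter_kneserStar F
          rw [hd]
          beta_reduce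
          exact_mod_cast this
  rw [← Finset.sum_add_sum_compl H]
  calc _ ≤ h * m + h / k * (r * F.card) := add_le_add hheavy hlight
    _ = _ := by ring

/-! ### Kneser edges spanned by a family -/

/-- The edges of the Kneser graph inside a family. -/
noncomputable def kneserEdges {n r : ℕ} (F : Finset (RSet n r)) : Finset (Sym2 (RSet n r)) := by
  classical exact ((F ×ˢ F).filter fun e => Disjoint e.1.1 e.2.1).image fun e => s(e.1, e.2)

theorem disjoint_ne {n r : ℕ} (hr : 1 ≤ r) {A B : RSet n r} (h : Disjoint A.1 B.1) : A ≠ B := by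
  rintro rfl
  rw [disjoint_self, Finset.bot_eq_empty] at h
  have := A.2
  simp [h] at this
  omega

theorem mem_edgeSet_kneserGraph {n r : ℕ} (hr : 1 ≤ r) {A B : RSet n r} :
    s(A, B) ∈ (kneserGraph n r).edgeSet ↔ Disjoint A.1 B.1 := by
  rw [SimpleGraph.mem_edgeSet]
  exact ⟨fun h => h.2, fun h => ⟨disjoint_ne hr h, h⟩⟩

theorem kneserEdges_subset {n r : ℕ} (hr : 1 ≤ r) (F : Finset (RSet n r)) :
    ↑(kneserEdges F) ⊆ (kneserGraph n r).edgeSet := by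
  classical
  intro e he
  simp only [kneserEdges, Finset.coe_image, Set.mem_image, Finset.mem_coe, Finset.mem_filter] at he
  obtain ⟨⟨A, B⟩, ⟨_, h⟩, rfl⟩ := he
  exact (mem_edgeSet_kneserGraph hr).2 h

theorem SimpleGraph.IsIndepSet.notMem_edgeSet_of_mem_kneserEdges {n r : ℕ} (hr : 1 ≤ r)
    {F : Finset (RSet n r)} {G : SimpleGraph (RSet n r)} (hG : G.IsIndepSet F) :
    ∀ e ∈ kneserEdges F, e ∉ G.edgeSet := by
  classical
  intro e he
  simp only [kneserEdges, Finset.mem_image, Finset.mem_filter, Finset.mem_product] at he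
  obtain ⟨⟨A, B⟩, ⟨⟨hA, hB⟩, h⟩, rfl⟩ := he
  exact hG hA hB (disjoint_ne hr h)

/-- An ordered pair of members of `F` is disjoint or lies in a common star, and an edge arises from
at most two ordered pairs. -/
theorem card_sq_sub_le_card_kneserEdges {n r : ℕ} (F : Finset (RSet n r)) :
    (F.card : ℝ) ^ 2 - ∑ x, ((F ∩ kneserStar n r x).card : ℝ) ^ 2 ≤ 2 * (kneserEdges F).card := by
  classical
  set D := (F ×ˢ F).filter fun e => Disjoint e.1.1 e.2.1 with hD
  have h1 : D.card ≤ 2 * (kneserEdges F).card := by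
    refine Finset.card_le_mul_card_image (f := fun e : RSet n r × RSet n r => s(e.1, e.2)) D 2 ?_
    intro b _
    induction b using Sym2.ind with
    | _ A B =>
      refine (Finset.card_le_card (t := {(A, B), (B, A)}) ?_).trans Finset.card_le_two
      rintro ⟨A', B'⟩ h
      have := (Finset.mem_filter.1 h).2
      simp only [Sym2.eq_iff] at this
      simp only [Finset.mem_insert, Finset.mem_singleton, Prod.mk.injEq]
      exact this
  have h2 : F.card ^ 2 ≤ D.card + ∑ x, (F ∩ kneserStar n r x).card ^ 2 := by
    have hsub : F ×ˢ F ⊆ D ∪ Finset.univ.biUnion fun x =>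
        (F ∩ kneserStar n r x) ×ˢ (F ∩ kneserStar n r x) := by
      rintro ⟨A, B⟩ h
      rw [Finset.mem_product] at h
      by_cases hAB : Disjoint A.1 B.1
      · exact Finset.mem_union_left _ (Finset.mem_filter.2 ⟨Finset.mem_product.2 h, hAB⟩)
      · obtain ⟨a, ha, hb⟩ := Finset.not_disjoint_iff.1 hAB
        refine Finset.mem_union_right _ (Finset.mem_biUnion.2 ⟨a, Finset.mem_univ _, ?_⟩)
        simp [h.1, h.2, ha, hb]
    calc F.card ^ 2 = (F ×ˢ F).card := by rw [Finset.card_product, sq]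
      _ ≤ _ := Finset.card_le_card hsub
      _ ≤ _ := (Finset.card_union_le _ _).trans (Nat.add_le_add_left Finset.card_biUnion_le _)
      _ = _ := by simp [Finset.card_product, sq]
  have h1' : (D.card : ℝ) ≤ 2 * (kneserEdges F).card := by exact_mod_cast h1
  have h2' : (F.card : ℝ) ^ 2 ≤ D.card + ∑ x, ((F ∩ kneserStar n r x).card : ℝ) ^ 2 := by
    exact_mod_cast h2
  linarith

/-- The degree bound with `k = K r` and maximal degree `V - i` gives squared degrees summing to at
most `V (V - i)` plus an error `δ V² / 8 ≤ i V / 8`. Half of the remaining `7/8 * i V` exceeds `5/12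
* i V`. -/
theorem card_sdiff_kneserStar_mul_le_card_kneserEdges {n r K : ℕ} {δ : ℝ} (hr : 2 ≤ r) (hK : 0 < K)
    (hδ : 0 ≤ δ) {F : Finset (RSet n r)} (hF : F.card = (n - 1).choose (r - 1)) {x : Fin n}
    (hmax : ∀ y, (F ∩ kneserStar n r y).card ≤ (F ∩ kneserStar n r x).card)
    (hi : δ * (n - 1).choose (r - 1) ≤ (F \ kneserStar n r x).card)
    (hW : ((K * r : ℕ) : ℝ) ^ 2 * (n - 2).choose (r - 2) ≤ δ / 12 * (n - 1).choose (r - 1))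
    (hKδ : 24 ≤ δ * K) :
    5 / 12 * (F \ kneserStar n r x).card * (n - 1).choose (r - 1) ≤ ((kneserEdges F).card : ℝ) := by
  have h1 := card_sq_sub_le_card_kneserEdges F
  have h2 := sum_sq_card_inter_kneserStar_le hr (k := K * r) (Nat.mul_pos hK (by omega)) F hmax
  have h3 : ((F \ kneserStar n r x).card : ℝ) + (F ∩ kneserStar n r x).card = F.card := by
    exact_mod_cast Finset.card_sdiff_add_card_inter F (kneserStar n r x)
  rw [hF] at h1 h2 h3
  set V : ℝ := ((n - 1).choose (r - 1) : ℝ)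
  set i : ℝ := ((F \ kneserStar n r x).card : ℝ)
  have hV : 0 ≤ V := by positivity
  have hi0 : 0 ≤ i := by positivity
  have hm : ((F ∩ kneserStar n r x).card : ℝ) = V - i := by linarith
  have hr0 : (0 : ℝ) < r := by exact_mod_cast (by omega : 0 < r)
  have hK0 : (0 : ℝ) < K := by exact_mod_cast hK
  have h4 : (r : ℝ) * V / (K * r : ℕ) ≤ δ / 24 * V := by
    rw [div_le_iff₀ (by positivity)]
    push_cast
    have : 0 ≤ r * V := by positivity
    nlinarith
  have h5 : (V + ((K * r : ℕ) : ℝ) ^ 2 * (n - 2).choose (r - 2)) *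
      ((F ∩ kneserStar n r x).card + r * V / (K * r : ℕ)) ≤
      (V + δ / 12 * V) * (V - i + δ / 24 * V) := by
    rw [hm]
    have : 0 ≤ V - i := by rw [← hm]; positivity
    gcongr
  have h6 : (V + δ / 12 * V) * (V - i + δ / 24 * V) ≤ V * (V - i + δ / 24 * V + δ / 12 * V) := by
    have : 0 ≤ δ / 12 * V * (i - δ / 24 * V) := by
      apply mul_nonneg (by positivity)
      have : 0 ≤ δ * V := by positivity
      linarith
    nlinarith
  have h7 : 0 ≤ V * (i - δ * V) := mul_nonneg hV (by linarith)
  nlinarith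

/-! ### Union bound for families far from every star -/

theorem choose_mul_eq_choose_pred_mul {n r : ℕ} (hn : 1 ≤ n) (hr : 1 ≤ r) :
    n * (n - 1).choose (r - 1) = n.choose r * r := by
  obtain ⟨n, rfl⟩ := Nat.exists_eq_add_of_le' hn
  obtain ⟨r, rfl⟩ := Nat.exists_eq_add_of_le' hr
  simpa using Nat.add_one_mul_choose_eq n r

theorem one_sub_pow_le_exp (p : unitInterval) (m : ℕ) :
    (1 - p : ℝ) ^ m ≤ Real.exp (-(p * m)) := by
  have h0 : (0 : ℝ) ≤ 1 - p := by linarith [p.2.2]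
  calc (1 - p : ℝ) ^ m ≤ Real.exp (-p) ^ m := by
        gcongr
        exact Real.one_sub_le_exp_neg _
    _ = _ := by rw [← Real.exp_nat_mul]; ring_nf

/-- The sum of `ρ ^ #(F \ S)` over all `F`. -/
theorem sum_pow_card_sdiff {α : Type*} [Fintype α] [DecidableEq α] (S : Finset α) {ρ : ℝ}
    (hρ : 0 ≤ ρ) :
    ∑ F : Finset α, ρ ^ (F \ S).card ≤ 2 ^ S.card * Real.exp (ρ * Fintype.card α) := by
  have h1 : ∀ F : Finset α, ρ ^ (F \ S).card = ∏ A ∈ F, if A ∈ S then 1 else ρ := by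
    intro F
    rw [Finset.prod_ite]
    simp [Finset.sdiff_eq_filter]
  simp_rw [h1]
  rw [← Finset.powerset_univ, ← Finset.prod_one_add]
  have h2 : ∀ A : α, (1 + if A ∈ S then (1 : ℝ) else ρ) ≤ (if A ∈ S then 2 else 1) * Real.exp ρ := by
    intro A
    have := Real.add_one_le_exp ρ
    split_ifs <;> linarith
  calc _ ≤ ∏ A : α, ((if A ∈ S then 2 else 1) * Real.exp ρ) :=
        Finset.prod_le_prod (fun A _ => by split_ifs <;> linarith) fun A _ => h2 A
    _ = _ := by
        rw [Finset.prod_mul_distrib, Finset.prod_ite, Finset.prod_const, Finset.prod_const,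
          Finset.prod_const, ← Real.exp_nat_mul]
        simp [mul_comm]

/-- With `ρ = r / n`, a family with `i` members off the star is independent with probability at most
`ρ ^ (5 i / 4)`. The factor `ρ ^ i` makes the sum over all families converge to at most `(2 e) ^ V`;
the spare `ρ ^ (i / 4)` is the gain. -/
theorem randomKneser_real_exists_far_le {n r : ℕ} (hr : 2 ≤ r) (hn : r ≤ n) (p : unitInterval)
    {δ : ℝ} (hp : Real.exp (-(5 / 12 * (p * (n - 1).choose (r - 1)))) ≤
      (r / n : ℝ) ^ (5 / 4 : ℝ)) :
    (randomKneser n r p).real {G | ∃ x, ∃ F : Finset (RSet n r),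
      δ * (n - 1).choose (r - 1) ≤ (F \ kneserStar n r x).card ∧
      5 / 12 * (F \ kneserStar n r x).card * (n - 1).choose (r - 1) ≤ ((kneserEdges F).card : ℝ) ∧
      G.IsIndepSet F} ≤
    n * ((2 * Real.exp 1) ^ (n - 1).choose (r - 1) *
      (r / n : ℝ) ^ (δ * (n - 1).choose (r - 1) / 4)) := by
  classical
  set V := (n - 1).choose (r - 1) with hV
  set ρ : ℝ := r / n with hρ
  have hn0 : (0 : ℝ) < n := by exact_mod_cast (by omega : 0 < n)
  have hr0 : (0 : ℝ) < r := by exact_mod_cast (by omega : 0 < r)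
  have hρ0 : 0 < ρ := by positivity
  have hρ1 : ρ ≤ 1 := by
    rw [hρ, div_le_one hn0]
    exact_mod_cast hn
  -- The weight `ρ` balances the sets off the star: their total weight is at most `ρ N = V`.
  have hρN : ρ * Fintype.card (RSet n r) = V := by
    rw [card_RSet, hρ]
    have : (n : ℝ) * V = n.choose r * r := by
      exact_mod_cast choose_mul_eq_choose_pred_mul (by omega : 1 ≤ n) (by omega : 1 ≤ r)
    field_simp
    linarith
  let 𝓕 : Fin n → Finset (Finset (RSet n r)) := fun x => Finset.univ.filter fun F =>
    δ * V ≤ (F \ kneserStar n r x).card ∧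
      5 / 12 * (F \ kneserStar n r x).card * V ≤ ((kneserEdges F).card : ℝ)
  have hsub : {G : SimpleGraph (RSet n r) | ∃ x, ∃ F : Finset (RSet n r),
      δ * V ≤ (F \ kneserStar n r x).card ∧
      5 / 12 * (F \ kneserStar n r x).card * V ≤ ((kneserEdges F).card : ℝ) ∧
      G.IsIndepSet F} ⊆
      ⋃ x ∈ (Finset.univ : Finset (Fin n)), ⋃ F ∈ 𝓕 x, {G | ∀ e ∈ kneserEdges F, e ∉ G.edgeSet} := by
    rintro G ⟨x, F, h1, h2, h3⟩
    simp only [Set.mem_iUnion]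
    exact ⟨x, Finset.mem_univ _, F, Finset.mem_filter.2 ⟨Finset.mem_univ _, h1, h2⟩,
      h3.notMem_edgeSet_of_mem_kneserEdges (by omega)⟩
  refine (measureReal_mono hsub (measure_ne_top _ _)).trans ((measureReal_biUnion_finset_le _ _).trans ?_)
  have hx : ∀ x ∈ (Finset.univ : Finset (Fin n)),
      (randomKneser n r p).real (⋃ F ∈ 𝓕 x, {G | ∀ e ∈ kneserEdges F, e ∉ G.edgeSet}) ≤
      (2 * Real.exp 1) ^ V * ρ ^ (δ * V / 4) := by
    intro x _
    refine (measureReal_biUnion_finset_le _ _).trans ?_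
    calc _ ≤ ∑ F ∈ 𝓕 x, ρ ^ (F \ kneserStar n r x).card * ρ ^ (δ * V / 4) := by
          refine Finset.sum_le_sum fun F hF => ?_
          obtain ⟨h1, h2⟩ := (Finset.mem_filter.1 hF).2
          rw [randomKneser, randomSubgraph_real_forall_notMem _ _ (kneserEdges_subset (by omega) F)]
          set i := (F \ kneserStar n r x).card
          calc _ ≤ Real.exp (-(p * (kneserEdges F).card)) := one_sub_pow_le_exp _ _
            _ ≤ Real.exp (-(5 / 12 * (p * V))) ^ i := by
                rw [← Real.exp_nat_mul]
                apply Real.exp_le_exp.2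
                have := mul_le_mul_of_nonneg_left h2 p.2.1
                linarith
            _ ≤ (ρ ^ (5 / 4 : ℝ)) ^ i := by gcongr
            _ = ρ ^ i * ρ ^ ((i : ℝ) / 4) := by
                rw [← Real.rpow_natCast, ← Real.rpow_mul hρ0.le, ← Real.rpow_natCast,
                  ← Real.rpow_add hρ0]
                ring_nf
            _ ≤ _ := by
                apply mul_le_mul_of_nonneg_left _ (by positivity)
                apply Real.rpow_le_rpow_of_exponent_ge hρ0 hρ1
                linarith
      _ ≤ ∑ F : Finset (RSet n r), ρ ^ (F \ kneserStar n r x).card * ρ ^ (δ * V / 4) :=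
          Finset.sum_le_sum_of_subset_of_nonneg (Finset.subset_univ _) fun F _ _ => by positivity
      _ ≤ _ := by
          rw [← Finset.sum_mul]
          gcongr
          have := sum_pow_card_sdiff (kneserStar n r x) hρ0.le
          rw [hρN, card_kneserStar (by omega) x] at this
          rwa [mul_pow, ← Real.exp_nat_mul, mul_one]
  refine (Finset.sum_le_sum hx).trans ?_
  rw [Finset.sum_const, Finset.card_univ, Fintype.card_fin, nsmul_eq_mul]

/-! ### Union bound for families near a star -/

theorem sym2_mk_inj_of_mem_of_notMem {n r : ℕ} {x : Fin n} {A B A' B' : RSet n r} (hA : x ∉ A.1)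
    (hB' : x ∈ B'.1) (h : s(A, B) = s(A', B')) : A = A' ∧ B = B' := by
  rcases Sym2.eq_iff.1 h with h | h
  · exact h
  · rw [h.1] at hA
    exact absurd hB' hA

/-- One term of the union bound: `T` is the neighbourhood of `F` in the star and `f` picks a
neighbour for each member of `T`. The required and the forbidden edges are disjoint, as their ends
in the star lie inside and outside `T`. -/
theorem randomKneser_real_neighbors_eq_le {n r : ℕ} (hr : 2 ≤ r) (p : unitInterval) {x : Fin n}
    {F T : Finset (RSet n r)} (hF : ∀ A ∈ F, x ∉ A.1) (hT : T ⊆ kneserStar n r x) (f : T → F) :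
    (randomKneser n r p).real {G | (∀ B : T, G.Adj (f B).1 B.1) ∧
      ∀ A ∈ F, ∀ B ∈ kneserStar n r x \ T, ¬ G.Adj A B} ≤
    p ^ T.card * Real.exp (-(p * (F.card * ((n - 1).choose (r - 1) -
      r * (n - 2).choose (r - 2) - T.card)))) := by
  classical
  set P : Finset (Sym2 (RSet n r)) := Finset.univ.image fun B : T => s((f B).1, B.1)
  set Q₀ := (F ×ˢ (kneserStar n r x \ T)).filter fun e => Disjoint e.1.1 e.2.1
  set Q : Finset (Sym2 (RSet n r)) := Q₀.image fun e => s(e.1, e.2)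
  have hPc : P.card = T.card := by
    rw [Finset.card_image_of_injective, Finset.card_univ, Fintype.card_coe]
    intro B B' h
    exact Subtype.ext (sym2_mk_inj_of_mem_of_notMem (hF _ (f B).2)
      (mem_kneserStar.1 (hT B'.2)) h).2
  have hmem : ∀ e ∈ Q₀, e.1 ∈ F ∧ e.2 ∈ kneserStar n r x ∧ e.2 ∉ T ∧ Disjoint e.1.1 e.2.1 := by
    intro e he
    simp only [Q₀, Finset.mem_filter, Finset.mem_product, Finset.mem_sdiff] at he
    tauto
  have hQc : Q.card = Q₀.card := by
    refine Finset.card_image_of_injOn fun e he e' he' h => ?_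
    have h' := sym2_mk_inj_of_mem_of_notMem (hF _ (hmem e he).1)
      (mem_kneserStar.1 (hmem e' he').2.1) h
    exact Prod.ext h'.1 h'.2
  have hPQ : Disjoint P Q := by
    rw [Finset.disjoint_left]
    intro e he he'
    obtain ⟨B, _, rfl⟩ := Finset.mem_image.1 he
    obtain ⟨e', he', h⟩ := Finset.mem_image.1 he'
    have h' := sym2_mk_inj_of_mem_of_notMem (hF _ (hmem e' he').1) (mem_kneserStar.1 (hT B.2)) h
    apply (hmem e' he').2.2.1
    rw [h'.2]
    exact B.2
  have hQs : ↑Q ⊆ (kneserGraph n r).edgeSet := by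
    intro e he
    obtain ⟨e', he', rfl⟩ := Finset.mem_image.1 he
    exact (mem_edgeSet_kneserGraph (by omega)).2 (hmem e' he').2.2.2
  have hsub : {G : SimpleGraph (RSet n r) | (∀ B : T, G.Adj (f B).1 B.1) ∧
      ∀ A ∈ F, ∀ B ∈ kneserStar n r x \ T, ¬ G.Adj A B} ⊆
      {G | ↑P ⊆ G.edgeSet ∧ ∀ e ∈ Q, e ∉ G.edgeSet} := by
    rintro G ⟨h1, h2⟩
    refine ⟨fun e he => ?_, fun e he => ?_⟩
    · obtain ⟨B, _, rfl⟩ := Finset.mem_image.1 he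
      exact h1 B
    · obtain ⟨e', he', rfl⟩ := Finset.mem_image.1 he
      have := hmem e' he'
      exact h2 _ this.1 _ (Finset.mem_sdiff.2 ⟨this.2.1, this.2.2.1⟩)
  have hcard : F.card * ((n - 1).choose (r - 1) - r * (n - 2).choose (r - 2) - T.card : ℝ) ≤
      Q.card := by
    have h1 : Q₀.card = ∑ A ∈ F, ((kneserStar n r x \ T).filter fun B => Disjoint A.1 B.1).card := by
      rw [Finset.card_filter, Finset.sum_product]
      simp_rw [Finset.card_filter]
    rw [hQc, h1]
    push_cast
    rw [← nsmul_eq_mul]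
    refine Finset.card_nsmul_le_sum _ _ _ fun A hA => ?_
    have h2 := choose_sub_le_card_filter_disjoint hr (hF A hA)
    have h3 : ((kneserStar n r x).filter fun B => Disjoint A.1 B.1).card ≤
        ((kneserStar n r x \ T).filter fun B => Disjoint A.1 B.1).card + T.card := by
      refine (Finset.card_le_card ?_).trans (Finset.card_union_le _ _)
      intro B hB
      rw [Finset.mem_filter] at hB
      by_cases hBT : B ∈ T
      · exact Finset.mem_union_right _ hBT
      · exact Finset.mem_union_left _
          (Finset.mem_filter.2 ⟨Finset.mem_sdiff.2 ⟨hB.1, hBT⟩, hB.2⟩)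
    have h4 := h2.trans (Nat.add_le_add_right h3 _)
    have h5 : ((n - 1).choose (r - 1) : ℝ) ≤
        ((kneserStar n r x \ T).filter fun B => Disjoint A.1 B.1).card + T.card +
          r * (n - 2).choose (r - 2) := by exact_mod_cast h4
    linarith
  refine (measureReal_mono hsub (measure_ne_top _ _)).trans ((randomSubgraph_real_le _ _ hQs hPQ).trans ?_)
  rw [hPc]
  have hp0 := p.2.1
  gcongr
  refine (one_sub_pow_le_exp p _).trans (Real.exp_le_exp.2 ?_)
  exact neg_le_neg (mul_le_mul_of_nonneg_left hcard hp0)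

open Classical in
/-- The members of the star centred at `x` that have a neighbour in `F`. -/
noncomputable def starNeighbors {n r : ℕ} (G : SimpleGraph (RSet n r)) (x : Fin n)
    (F : Finset (RSet n r)) : Finset (RSet n r) :=
  (kneserStar n r x).filter fun B => ∃ A ∈ F, G.Adj A B

/-- Sum over the neighbourhood `T` and the witnesses `f`. The three losses of `δ` come from the sets
meeting a member of `F`, from `#T ≤ #F`, and from the sum over `T`. -/
theorem randomKneser_real_card_starNeighbors_le {n r : ℕ} (hr : 2 ≤ r) (p : unitInterval) {x : Fin n}
    {F : Finset (RSet n r)} (hF : ∀ A ∈ F, x ∉ A.1) {δ : ℝ} (hδ0 : 0 < δ) (hδ1 : δ ≤ 1)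
    (hW : (r * (n - 2).choose (r - 2) : ℝ) ≤ δ * (n - 1).choose (r - 1))
    (hFc : (F.card : ℝ) ≤ δ * (n - 1).choose (r - 1)) :
    (randomKneser n r p).real {G | (starNeighbors G x F).card ≤ F.card} ≤
      (δ⁻¹ * Real.exp (-((1 - 3 * δ) * (p * (n - 1).choose (r - 1))))) ^ F.card := by
  classical
  set V := (n - 1).choose (r - 1) with hV
  have hp0 := p.2.1
  let 𝓣 := (kneserStar n r x).powerset.filter fun T => T.card ≤ F.card
  have hsub : {G : SimpleGraph (RSet n r) | (starNeighbors G x F).card ≤ F.card} ⊆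
      ⋃ T ∈ 𝓣, ⋃ f ∈ (Finset.univ : Finset (T → F)), {G | (∀ B : T, G.Adj (f B).1 B.1) ∧
        ∀ A ∈ F, ∀ B ∈ kneserStar n r x \ T, ¬ G.Adj A B} := by
    intro G hG
    simp only [Set.mem_iUnion]
    have hex : ∀ B : starNeighbors G x F, ∃ A : F, G.Adj A.1 B.1 := by
      intro B
      obtain ⟨A, hA, h⟩ := (Finset.mem_filter.1 B.2).2
      exact ⟨⟨A, hA⟩, h⟩
    choose f hf using hex
    refine ⟨starNeighbors G x F, ?_, f, Finset.mem_univ _, hf, ?_⟩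
    · exact Finset.mem_filter.2 ⟨Finset.mem_powerset.2 (Finset.filter_subset _ _), hG⟩
    · intro A hA B hB h
      rw [Finset.mem_sdiff] at hB
      exact hB.2 (Finset.mem_filter.2 ⟨hB.1, A, hA, h⟩)
  refine (measureReal_mono hsub (measure_ne_top _ _)).trans ((measureReal_biUnion_finset_le _ _).trans ?_)
  set i := F.card with hi
  set E := Real.exp (-(p * (i * ((1 - 2 * δ) * V)))) with hE
  have hT : ∀ T ∈ 𝓣, (randomKneser n r p).real
      (⋃ f ∈ (Finset.univ : Finset (T → F)), {G | (∀ B : T, G.Adj (f B).1 B.1) ∧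
        ∀ A ∈ F, ∀ B ∈ kneserStar n r x \ T, ¬ G.Adj A B}) ≤
      δ⁻¹ ^ i * E * (δ * i * p) ^ T.card := by
    intro T hT
    obtain ⟨hT1, hT2⟩ := Finset.mem_filter.1 hT
    refine (measureReal_biUnion_finset_le _ _).trans ?_
    have hT2' : (T.card : ℝ) ≤ i := by exact_mod_cast hT2
    have h1 : ∀ f ∈ (Finset.univ : Finset (T → F)),
        (randomKneser n r p).real {G | (∀ B : T, G.Adj (f B).1 B.1) ∧
        ∀ A ∈ F, ∀ B ∈ kneserStar n r x \ T, ¬ G.Adj A B} ≤ p ^ T.card * E := by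
      intro f _
      refine (randomKneser_real_neighbors_eq_le hr p hF (Finset.mem_powerset.1 hT1) f).trans ?_
      refine mul_le_mul_of_nonneg_left (Real.exp_le_exp.2 (neg_le_neg ?_)) (by positivity)
      gcongr
      linarith
    refine (Finset.sum_le_sum h1).trans ?_
    rw [Finset.sum_const, Finset.card_univ, Fintype.card_fun, Fintype.card_coe, Fintype.card_coe,
      nsmul_eq_mul, ← hi]
    push_cast
    -- Inserting this factor costs `δ⁻¹` per member of `F`, but reduces the sum over `T` from `exp(i
    -- p V)`, which would cancel the whole gain, to `exp(δ i p V)`.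
    have h2 : (1 : ℝ) ≤ δ⁻¹ ^ i * δ ^ T.card := by
      rw [inv_pow, inv_mul_eq_div, one_le_div (by positivity)]
      exact pow_le_pow_of_le_one hδ0.le hδ1 hT2
    calc (i : ℝ) ^ T.card * (p ^ T.card * E) = 1 * (i ^ T.card * p ^ T.card * E) := by ring
      _ ≤ (δ⁻¹ ^ i * δ ^ T.card) * (i ^ T.card * p ^ T.card * E) := by
          apply mul_le_mul_of_nonneg_right h2
          positivity
      _ = _ := by rw [mul_pow, mul_pow]; ring
  have hsum : ∑ T ∈ 𝓣, (δ * i * p : ℝ) ^ T.card ≤ Real.exp (δ * i * p * V) := by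
    calc _ ≤ ∑ T ∈ (kneserStar n r x).powerset, (δ * i * p : ℝ) ^ T.card :=
          Finset.sum_le_sum_of_subset_of_nonneg (Finset.filter_subset _ _) fun _ _ _ => by positivity
      _ = (1 + δ * i * p : ℝ) ^ V := by
          rw [hV, ← card_kneserStar (by omega) x, ← Finset.prod_const, Finset.prod_one_add]
          simp
      _ ≤ Real.exp (δ * i * p) ^ V := by
          gcongr
          linarith [Real.add_one_le_exp (δ * i * p : ℝ)]
      _ = _ := by rw [← Real.exp_nat_mul]; ring_nf
  refine (Finset.sum_le_sum hT).trans ?_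
  rw [← Finset.mul_sum]
  calc _ ≤ δ⁻¹ ^ i * E * Real.exp (δ * i * p * V) := by gcongr
    _ = _ := by
      rw [mul_pow, hE, mul_assoc, ← Real.exp_add, ← Real.exp_nat_mul]
      ring_nf

/-- For each centre, `∑ z ^ #F` over all families is at most `exp(N z)`; the `- 1` removes the empty
family, so the bound is of order `n N z` when `N z` is small. -/
theorem randomKneser_real_exists_near_le {n r : ℕ} (hr : 2 ≤ r) (p : unitInterval)
    {δ : ℝ} (hδ0 : 0 < δ) (hδ1 : δ ≤ 1)
    (hW : (r * (n - 2).choose (r - 2) : ℝ) ≤ δ * (n - 1).choose (r - 1)) :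
    (randomKneser n r p).real {G | ∃ x, ∃ F : Finset (RSet n r), F.Nonempty ∧
      (∀ A ∈ F, x ∉ A.1) ∧ (F.card : ℝ) ≤ δ * (n - 1).choose (r - 1) ∧
      (starNeighbors G x F).card ≤ F.card} ≤
    n * (Real.exp (n.choose r *
      (δ⁻¹ * Real.exp (-((1 - 3 * δ) * (p * (n - 1).choose (r - 1)))))) - 1) := by
  classical
  set V := (n - 1).choose (r - 1) with hV
  set z := δ⁻¹ * Real.exp (-((1 - 3 * δ) * (p * V))) with hz
  have hz0 : 0 ≤ z := by positivity
  let 𝓕 : Fin n → Finset (Finset (RSet n r)) := fun x => (Finset.univ.erase ∅).filter fun F =>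
    (∀ A ∈ F, x ∉ A.1) ∧ (F.card : ℝ) ≤ δ * V
  have hsub : {G : SimpleGraph (RSet n r) | ∃ x, ∃ F : Finset (RSet n r), F.Nonempty ∧
      (∀ A ∈ F, x ∉ A.1) ∧ (F.card : ℝ) ≤ δ * V ∧ (starNeighbors G x F).card ≤ F.card} ⊆
      ⋃ x ∈ (Finset.univ : Finset (Fin n)), ⋃ F ∈ 𝓕 x,
        {G | (starNeighbors G x F).card ≤ F.card} := by
    rintro G ⟨x, F, h0, h1, h2, h3⟩
    simp only [Set.mem_iUnion]
    exact ⟨x, Finset.mem_univ _, F, Finset.mem_filter.2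
      ⟨Finset.mem_erase.2 ⟨h0.ne_empty, Finset.mem_univ _⟩, h1, h2⟩, h3⟩
  refine (measureReal_mono hsub (measure_ne_top _ _)).trans ((measureReal_biUnion_finset_le _ _).trans ?_)
  have hx : ∀ x ∈ (Finset.univ : Finset (Fin n)),
      (randomKneser n r p).real (⋃ F ∈ 𝓕 x, {G | (starNeighbors G x F).card ≤ F.card}) ≤
      Real.exp (n.choose r * z) - 1 := by
    intro x _
    refine (measureReal_biUnion_finset_le _ _).trans ?_
    calc _ ≤ ∑ F ∈ 𝓕 x, z ^ F.card := by
          refine Finset.sum_le_sum fun F hF => ?_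
          obtain ⟨h1, h2⟩ := (Finset.mem_filter.1 hF).2
          exact randomKneser_real_card_starNeighbors_le hr p h1 hδ0 hδ1 hW h2
      _ ≤ ∑ F ∈ Finset.univ.erase (∅ : Finset (RSet n r)), z ^ F.card :=
          Finset.sum_le_sum_of_subset_of_nonneg (Finset.filter_subset _ _) fun _ _ _ => by positivity
      _ = ∑ F : Finset (RSet n r), z ^ F.card - 1 := by
          rw [← Finset.sum_erase_add _ _ (Finset.mem_univ (∅ : Finset (RSet n r)))]
          simp
      _ ≤ _ := by
          have := sum_pow_card_sdiff (∅ : Finset (RSet n r)) hz0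
          rw [card_RSet] at this
          simp only [Finset.sdiff_empty, Finset.card_empty, pow_zero, one_mul] at this
          rw [mul_comm]
          linarith
  refine (Finset.sum_le_sum hx).trans ?_
  rw [Finset.sum_const, Finset.card_univ, Fintype.card_fin, nsmul_eq_mul]

/-! ### From independent sets to stars, deterministically -/

theorem isIndepSet_kneserStar {n r : ℕ} {G : SimpleGraph (RSet n r)} (hG : G ≤ kneserGraph n r)
    (x : Fin n) : G.IsIndepSet (kneserStar n r x) := by
  intro A hA B hB _ h
  exact Finset.disjoint_left.1 (hG h).2 (mem_kneserStar.1 hA) (mem_kneserStar.1 hB)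

/-- By independence, the neighbours in the star of `F \ kneserStar n r x` avoid `F`. As `F` and the
star have equal size, the two differences do too. -/
theorem exists_star_of_isNIndepSet {n r : ℕ} (hn : 0 < n) (hr : 1 ≤ r) {G : SimpleGraph (RSet n r)}
    {F : Finset (RSet n r)} (hF : G.IsNIndepSet ((n - 1).choose (r - 1)) F)
    (hstar : ∀ x, F ≠ kneserStar n r x) :
    ∃ x, (∀ y, (F ∩ kneserStar n r y).card ≤ (F ∩ kneserStar n r x).card) ∧
      (F \ kneserStar n r x).Nonempty ∧
      (starNeighbors G x (F \ kneserStar n r x)).card ≤ (F \ kneserStar n r x).card := by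
  classical
  have : Nonempty (Fin n) := ⟨⟨0, hn⟩⟩
  obtain ⟨x, hx⟩ := Finite.exists_max fun y => (F ∩ kneserStar n r y).card
  refine ⟨x, hx, ?_, ?_⟩
  · rw [Finset.nonempty_iff_ne_empty]
    intro h
    exact hstar x (Finset.eq_of_subset_of_card_le (Finset.sdiff_eq_empty_iff_subset.1 h)
      (by rw [card_kneserStar hr, hF.card_eq]))
  · have hsub : starNeighbors G x (F \ kneserStar n r x) ⊆ kneserStar n r x \ F := by
      intro B hB
      obtain ⟨hBx, A, hA, hAB⟩ := Finset.mem_filter.1 hB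
      rw [Finset.mem_sdiff] at hA
      refine Finset.mem_sdiff.2 ⟨hBx, fun hBF => hF.isIndepSet hA.1 hBF ?_ hAB⟩
      rintro rfl
      exact hA.2 hBx
    refine (Finset.card_le_card hsub).trans (le_of_eq ?_)
    have h1 := Finset.card_sdiff_add_card_inter F (kneserStar n r x)
    have h2 := Finset.card_sdiff_add_card_inter (kneserStar n r x) F
    rw [card_kneserStar hr, Finset.inter_comm] at h2
    rw [hF.card_eq] at h1
    omega

/-- In an independent set of size `V + 1`, deleting either of two points would leave a star. These
two stars would share `V - 1 > W` members. -/
theorem indepNum_eq_of_forall_isNIndepSet_iff {n r : ℕ} (hn : 0 < n) (hr : 2 ≤ r)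
    (hW : (n - 2).choose (r - 2) + 1 < (n - 1).choose (r - 1)) {G : SimpleGraph (RSet n r)}
    (hG : ∀ 𝒜, G.IsNIndepSet ((n - 1).choose (r - 1)) 𝒜 ↔ ∃ x, 𝒜 = kneserStar n r x) :
    G.indepNum = (n - 1).choose (r - 1) := by
  classical
  apply le_antisymm
  · by_contra! hlt
    obtain ⟨s, hs⟩ := G.exists_isNIndepSet_indepNum
    obtain ⟨t, hts, ht⟩ := Finset.exists_subset_card_eq (s := s)
      (n := (n - 1).choose (r - 1) + 1) (by rw [hs.card_eq]; omega)
    have hti : ∀ A ∈ t, ∃ x, t.erase A = kneserStar n r x := by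
      intro A hA
      rw [← hG]
      refine ⟨fun B hB C hC hne => hs.isIndepSet ?_ ?_ hne, ?_⟩
      · exact hts (Finset.mem_of_mem_erase hB)
      · exact hts (Finset.mem_of_mem_erase hC)
      · rw [Finset.card_erase_of_mem hA, ht]
        rfl
    obtain ⟨A, hA, B, hB, hAB⟩ := Finset.one_lt_card.1 (by omega : 1 < t.card)
    obtain ⟨x, hx⟩ := hti A hA
    obtain ⟨y, hy⟩ := hti B hB
    have hxy : x ≠ y := by
      rintro rfl
      rw [← hy] at hx
      have : B ∈ t.erase A := Finset.mem_erase.2 ⟨hAB.symm, hB⟩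
      rw [hx] at this
      exact (Finset.notMem_erase B t) this
    have h1 := card_inter_kneserStar hr hxy
    have h2 : t.erase A ∩ t.erase B = (t.erase A).erase B := by
      ext C
      simp only [Finset.mem_inter, Finset.mem_erase]
      tauto
    rw [← hx, ← hy, h2, Finset.card_erase_of_mem (Finset.mem_erase.2 ⟨hAB.symm, hB⟩),
      Finset.card_erase_of_mem hA, ht] at h1
    omega
  · have h := (hG (kneserStar n r ⟨0, hn⟩)).2 ⟨_, rfl⟩
    rw [← h.card_eq]
    exact h.isIndepSet.card_le_indepNum

/-! ### Enlarging a star below the threshold -/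

/-- The Kneser edges between `A` and the star centred at `x`. -/
noncomputable def edgesToStar {n r : ℕ} (x : Fin n) (A : RSet n r) : Finset (Sym2 (RSet n r)) := by
  classical exact ((kneserStar n r x).filter fun B => Disjoint A.1 B.1).image fun B => s(A, B)

theorem mem_edgesToStar {n r : ℕ} {x : Fin n} {A : RSet n r} {e : Sym2 (RSet n r)} :
    e ∈ edgesToStar x A ↔ ∃ B : RSet n r, x ∈ B.1 ∧ Disjoint A.1 B.1 ∧ s(A, B) = e := by
  classical
  simp [edgesToStar, and_assoc]

theorem edgesToStar_subset {n r : ℕ} (hr : 1 ≤ r) (x : Fin n) (A : RSet n r) :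
    ↑(edgesToStar x A) ⊆ (kneserGraph n r).edgeSet := by
  intro e he
  obtain ⟨B, _, h, rfl⟩ := mem_edgesToStar.1 he
  exact (mem_edgeSet_kneserGraph hr).2 h

theorem card_edgesToStar_le {n r : ℕ} (hr : 1 ≤ r) (x : Fin n) (A : RSet n r) :
    (edgesToStar x A).card ≤ (n - 1).choose (r - 1) := by
  classical
  rw [← card_kneserStar hr x, edgesToStar]
  exact Finset.card_image_le.trans (Finset.card_filter_le _ _)

-- For equal outside sets, shared edges end in both stars. For distinct ones, only `s(A, A')` can be
-- shared.
open Classical in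
theorem card_edgesToStar_inter_le {n r : ℕ} (hr : 2 ≤ r) (hn : r ≤ n) {x y : Fin n}
    {A A' : RSet n r} (hne : (x, A) ≠ (y, A')) :
    (edgesToStar x A ∩ edgesToStar y A').card ≤ (n - 2).choose (r - 2) := by
  by_cases hA : A = A'
  · subst hA
    have hxy : x ≠ y := fun h => hne (by rw [h])
    rw [← card_inter_kneserStar hr hxy]
    refine (Finset.card_le_card ?_).trans
      (Finset.card_image_le (s := kneserStar n r x ∩ kneserStar n r y) (f := fun B => s(A, B)))
    intro e he
    rw [Finset.mem_inter] at he
    obtain ⟨B, hxB, _, rfl⟩ := mem_edgesToStar.1 he.1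
    obtain ⟨B', hyB, _, h⟩ := mem_edgesToStar.1 he.2
    rw [Sym2.congr_right] at h
    subst h
    refine Finset.mem_image.2 ⟨B', ?_, rfl⟩
    simp [hxB, hyB]
  · have h1 : (edgesToStar x A ∩ edgesToStar y A').card ≤ 1 := by
      refine (Finset.card_le_card (t := {s(A, A')}) ?_).trans (by simp)
      intro e he
      rw [Finset.mem_inter] at he
      obtain ⟨B, hxB, _, rfl⟩ := mem_edgesToStar.1 he.1
      obtain ⟨B', hyB, _, h⟩ := mem_edgesToStar.1 he.2
      rw [Finset.mem_singleton]
      rcases Sym2.eq_iff.1 h with h | h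
      · exact absurd h.1.symm hA
      · rw [h.1]
    exact h1.trans (Nat.choose_pos (by omega))

theorem card_notMem_pairs (n r : ℕ) :
    Fintype.card {q : Fin n × RSet n r // q.1 ∉ q.2.1} = n.choose r * (n - r) := by
  classical
  rw [Fintype.card_subtype, Finset.card_filter, Fintype.sum_prod_type_right]
  have : ∀ A : RSet n r, (∑ x : Fin n, if x ∉ A.1 then 1 else 0) = n - r := by
    intro A
    rw [← Finset.card_filter]
    have : (Finset.univ.filter fun x => x ∉ A.1) = A.1ᶜ := by ext; simp
    rw [this, Finset.card_compl, A.2, Fintype.card_fin]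
  simp only [this, Finset.sum_const, Finset.card_univ, card_RSet, smul_eq_mul]

/-- If `A` has no edge to the star at `x`, adding it gives an independent set of size `V + 1`. The
second moment bound applies to these events. -/
theorem randomKneser_real_indepNum_eq_le {n r : ℕ} (hr : 2 ≤ r) (hn : r < n) (p : unitInterval)
    (hp : (p * (n - 2).choose (r - 2) : ℝ) < 1) :
    (randomKneser n r p).real {G | G.indepNum = (n - 1).choose (r - 1)} ≤
      ((n.choose r * (n - r : ℕ) : ℝ) * (1 - p) ^ (n - 1).choose (r - 1))⁻¹ +
        ((1 - (p : ℝ) * (n - 2).choose (r - 2))⁻¹ - 1) := by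
  classical
  set V := (n - 1).choose (r - 1) with hV
  set W := (n - 2).choose (r - 2) with hW
  have hW1 : 1 ≤ W := Nat.choose_pos (by omega)
  have hp0 := p.2.1
  have hp1 : (p : ℝ) < 1 := by
    refine lt_of_le_of_lt ?_ hp
    have : (1 : ℝ) ≤ W := by exact_mod_cast hW1
    nlinarith
  set q : ℝ := 1 - p with hq
  have hq0 : 0 < q := by rw [hq]; linarith
  have hq1 : q ≤ 1 := by rw [hq]; linarith
  let J := {q : Fin n × RSet n r // q.1 ∉ q.2.1}
  let E : J → Set (SimpleGraph (RSet n r)) :=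
    fun j => {G | ∀ e ∈ edgesToStar j.1.1 j.1.2, e ∉ G.edgeSet}
  have hE : ∀ j, (randomKneser n r p).real (E j) = q ^ (edgesToStar j.1.1 j.1.2).card := fun j =>
    randomSubgraph_real_forall_notMem _ _ (edgesToStar_subset (by omega) _ _)
  have hsum : (n.choose r * (n - r : ℕ) : ℝ) * q ^ V ≤ ∑ j, (randomKneser n r p).real (E j) := by
    have h := card_notMem_pairs n r
    have h' : (n.choose r * (n - r : ℕ) : ℝ) = (Finset.univ : Finset J).card := by
      rw [Finset.card_univ, h]
      push_cast
      rfl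
    rw [h', ← nsmul_eq_mul]
    refine Finset.card_nsmul_le_sum _ _ _ fun j _ => ?_
    rw [hE]
    exact pow_le_pow_of_le_one hq0.le hq1 (card_edgesToStar_le (by omega) _ _)
  have hpos : 0 < (n.choose r * (n - r : ℕ) : ℝ) * q ^ V := by
    have h1 : 0 < n.choose r := Nat.choose_pos hn.le
    have h2 : 0 < n - r := by omega
    positivity
  -- Shared edges are counted once in the intersection and twice in the product, so the correlation
  -- is `q` to the power minus their number, hence at most `q ^ (-W)`.
  have hpair : ∀ i j, i ≠ j → (randomKneser n r p).real (E i ∩ E j) ≤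
      (q ^ W)⁻¹ * ((randomKneser n r p).real (E i) * (randomKneser n r p).real (E j)) := by
    intro i j hij
    have h1 : E i ∩ E j = {G | ∀ e ∈ edgesToStar i.1.1 i.1.2 ∪ edgesToStar j.1.1 j.1.2,
        e ∉ G.edgeSet} := by
      ext G
      simp only [E, Set.mem_inter_iff, Set.mem_ofPred_eq, Finset.mem_union]
      exact ⟨fun h e he => he.elim (h.1 e) (h.2 e),
        fun h => ⟨fun e he => h e (Or.inl he), fun e he => h e (Or.inr he)⟩⟩
    have h2 : (randomKneser n r p).real (E i ∩ E j) =
        q ^ (edgesToStar i.1.1 i.1.2 ∪ edgesToStar j.1.1 j.1.2).card := by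
      rw [h1]
      refine randomSubgraph_real_forall_notMem _ _ ?_
      rw [Finset.coe_union]
      exact Set.union_subset (edgesToStar_subset (by omega) _ _)
        (edgesToStar_subset (by omega) _ _)
    rw [h2, hE, hE, ← pow_add, ← Finset.card_union_add_card_inter, pow_add, inv_mul_eq_div,
      le_div_iff₀ (by positivity)]
    apply mul_le_mul_of_nonneg_left _ (by positivity)
    refine pow_le_pow_of_le_one hq0.le hq1 (card_edgesToStar_inter_le hr hn.le ?_)
    exact fun h => hij (Subtype.ext h)
  have hmain := measureReal_forall_notMem_le (randomKneser n r p) E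
    (fun _ => MeasurableSet.of_discrete) (by positivity) hpair (hpos.trans_le hsum)
  have hle : (randomKneser n r p).real {G | G.indepNum = V} ≤
      (randomKneser n r p).real {G | ∀ j, G ∉ E j} := by
    refine ENNReal.toReal_mono (measure_ne_top _ _) (measure_mono_ae ?_)
    filter_upwards [randomSubgraph_ae_le (kneserGraph n r) p] with G hG hind j hj
    have hind' : G.indepNum = V := hind
    have hins : G.IsIndepSet ↑(insert j.1.2 (kneserStar n r j.1.1)) := by
      have hno : ∀ B ∈ kneserStar n r j.1.1, ¬ G.Adj j.1.2 B := by
        intro B hB hadj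
        exact hj s(j.1.2, B)
          (mem_edgesToStar.2 ⟨B, mem_kneserStar.1 hB, (hG hadj).2, rfl⟩) hadj
      intro A hA B hB hne hadj
      rw [Finset.mem_coe, Finset.mem_insert] at hA hB
      rcases hA with rfl | hA
      · rcases hB with rfl | hB
        · exact hne rfl
        · exact hno B hB hadj
      · rcases hB with rfl | hB
        · exact hno A hA hadj.symm
        · exact isIndepSet_kneserStar hG _ hA hB hne hadj
    have := hins.card_le_indepNum
    rw [Finset.card_insert_of_notMem (by simpa using j.2), card_kneserStar (by omega), hind'] at this
    omega
  refine hle.trans (hmain.trans ?_)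
  gcongr
  have := one_add_mul_le_pow (a := -(p : ℝ)) (by linarith) W
  rw [hq]
  calc _ = 1 + (W : ℝ) * -(p : ℝ) := by ring
    _ ≤ _ := this
    _ = _ := by ring

/-! ### Binomial estimates and the threshold exponent -/

theorem self_le_choose {m k : ℕ} (hk : 1 ≤ k) (hm : k < m) : m ≤ m.choose k := by
  induction m generalizing k with
  | zero => omega
  | succ m ih =>
    obtain ⟨k, rfl⟩ := Nat.exists_eq_add_of_le' hk
    rw [Nat.choose_succ_succ']
    have h1 : 1 ≤ m.choose k := Nat.choose_pos (by omega)
    rcases Nat.lt_or_ge (k + 1) m with h | h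
    · have := ih hk h
      omega
    · have h2 : m = k + 1 := by omega
      subst h2
      simp

theorem div_pow_le_choose {n r : ℕ} (hr : 1 ≤ r) (hn : r ≤ n) :
    (n / r : ℝ) ^ r ≤ n.choose r := by
  induction r, hr using Nat.le_induction generalizing n with
  | base => simp
  | succ r hr ih =>
    obtain ⟨n, rfl⟩ := Nat.exists_eq_add_of_le' (by omega : 1 ≤ n)
    have h1 := ih (n := n) (by omega)
    have hr0 : (0 : ℝ) < r := by exact_mod_cast hr
    have hle : (r : ℝ) ≤ n := by exact_mod_cast (by omega : r ≤ n)
    have h2 : ((n + 1 : ℕ) / (r + 1 : ℕ) : ℝ) ≤ n / r := by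
      rw [div_le_div_iff₀ (by positivity) hr0]
      push_cast
      nlinarith
    have h3 : ((n + 1 : ℕ) : ℝ) * n.choose r = (n + 1).choose (r + 1) * (r + 1 : ℕ) := by
      exact_mod_cast Nat.add_one_mul_choose_eq n r
    have h4 : ((n + 1).choose (r + 1) : ℝ) = (n + 1 : ℕ) / (r + 1 : ℕ) * n.choose r := by
      rw [div_mul_eq_mul_div, h3]
      field_simp
    rw [h4, pow_succ']
    gcongr
    exact (pow_le_pow_left₀ (by positivity) h2 r).trans h1

theorem choose_le_div_pow_mul_exp {n r : ℕ} (hr : 1 ≤ r) :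
    (n.choose r : ℝ) ≤ (n / r : ℝ) ^ r * Real.exp r := by
  have hr0 : (0 : ℝ) < r := by exact_mod_cast hr
  calc (n.choose r : ℝ) ≤ n ^ r / r.factorial := Nat.choose_le_pow_div r n
    _ = (n / r : ℝ) ^ r * (r ^ r / r.factorial) := by
        rw [div_pow]
        field_simp
    _ ≤ _ := by
        gcongr
        exact Real.pow_div_factorial_le_exp _ hr0.le _

/-- Two distinct stars share at most the proportion `r / n` of their members. -/
theorem mul_choose_sub_two_le {n r : ℕ} (hr : 2 ≤ r) (hn : r ≤ n) :
    (n : ℝ) * (n - 2).choose (r - 2) ≤ r * (n - 1).choose (r - 1) := by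
  have h := choose_mul_eq_choose_pred_mul (n := n - 1) (r := r - 1) (by omega) (by omega)
  rw [Nat.sub_sub, Nat.sub_sub] at h
  have hn1 : ((n - 1 : ℕ) : ℝ) = n - 1 := by push_cast [show 1 ≤ n by omega]; rfl
  have hr1 : ((r - 1 : ℕ) : ℝ) = r - 1 := by push_cast [show 1 ≤ r by omega]; rfl
  have h' : ((n : ℝ) - 1) * (n - 2).choose (r - 2) = (n - 1).choose (r - 1) * (r - 1) := by
    rw [← hn1, ← hr1]
    exact_mod_cast h
  have hrn : (r : ℝ) ≤ n := by exact_mod_cast hn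
  have hr2 : (2 : ℝ) ≤ r := by exact_mod_cast hr
  have hV : (0 : ℝ) ≤ (n - 1).choose (r - 1) := by positivity
  have h3 : ((n : ℝ) - 1) * (n * (n - 2).choose (r - 2)) ≤
      (n - 1) * (r * (n - 1).choose (r - 1)) := by
    calc _ = (n : ℝ) * ((r - 1) * (n - 1).choose (r - 1)) := by linear_combination (n : ℝ) * h'
      _ ≤ _ := by nlinarith
  exact le_of_mul_le_mul_left h3 (by linarith)

/-- The numerator of `pCrit`. -/
noncomputable def critExponent (n r : ℕ) : ℝ := ((r : ℝ) + 1) * Real.log n - r * Real.log r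

theorem critExponent_eq {n r : ℕ} (hr : 1 ≤ r) (hn : r ≤ n) :
    critExponent n r = r * Real.log (n / r) + Real.log n := by
  have hr0 : (r : ℝ) ≠ 0 := by exact_mod_cast (by omega : r ≠ 0)
  have hn0 : (n : ℝ) ≠ 0 := by exact_mod_cast (by omega : n ≠ 0)
  rw [critExponent, Real.log_div hn0 hr0]
  ring

/-- Up to a factor `e ^ r` this is `n * C(n, r)`, the union bound count of centres and sets; hence
the numerator of the threshold. -/
theorem exp_critExponent {n r : ℕ} (hr : 1 ≤ r) (hn : r ≤ n) :
    Real.exp (critExponent n r) = (n / r : ℝ) ^ r * n := by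
  have hr0 : (0 : ℝ) < r := by exact_mod_cast hr
  have hn0 : (0 : ℝ) < n := by exact_mod_cast (by omega : 0 < n)
  rw [critExponent_eq hr hn, Real.exp_add, Real.exp_nat_mul, Real.exp_log (by positivity),
    Real.exp_log hn0]

theorem log_div_nonneg {n r : ℕ} (hr : 1 ≤ r) (hn : r ≤ n) : 0 ≤ Real.log (n / r) := by
  have hr0 : (0 : ℝ) < r := by exact_mod_cast hr
  apply Real.log_nonneg
  rw [one_le_div hr0]
  exact_mod_cast hn

theorem log_le_critExponent {n r : ℕ} (hr : 1 ≤ r) (hn : r ≤ n) :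
    Real.log n ≤ critExponent n r := by
  rw [critExponent_eq hr hn]
  have := mul_nonneg (Nat.cast_nonneg (α := ℝ) r) (log_div_nonneg hr hn)
  linarith

theorem critExponent_nonneg {n r : ℕ} (hr : 1 ≤ r) (hn : r ≤ n) : 0 ≤ critExponent n r :=
  (Real.log_natCast_nonneg n).trans (log_le_critExponent hr hn)

/-- This is where `r ≥ 2` matters for far families: `3 * 5/12 = 5/4` exceeds `1`. -/
theorem three_mul_log_div_le_critExponent {n r : ℕ} (hr : 2 ≤ r) (hn : r ≤ n) :
    3 * Real.log (n / r) ≤ critExponent n r := by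
  have hr0 : (2 : ℝ) ≤ r := by exact_mod_cast hr
  have hn0 : (0 : ℝ) < n := by exact_mod_cast (by omega : 0 < n)
  have h1 := log_div_nonneg (by omega : 1 ≤ r) hn
  have h2 : Real.log (n / r) ≤ Real.log n := by
    apply Real.log_le_log (by positivity)
    exact div_le_self hn0.le (by linarith)
  rw [critExponent_eq (by omega) hn]
  nlinarith

/-! ### Explicit probability bounds -/

/-- The constant `16 / δ` turns the gain into `exp(-4 V)`, against `exp(2 V)` for the families and
`exp V` for the centres; finally `V ≥ n - 1`. -/
theorem randomKneser_real_far_bound {n r : ℕ} (hr : 2 ≤ r) (hn : r < n) (p : unitInterval) {δ : ℝ}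
    (hδ : 0 < δ) (hp : critExponent n r ≤ p * (n - 1).choose (r - 1))
    (hρ : (r / n : ℝ) ≤ Real.exp (-(16 / δ))) :
    (randomKneser n r p).real {G | ∃ x, ∃ F : Finset (RSet n r),
      δ * (n - 1).choose (r - 1) ≤ (F \ kneserStar n r x).card ∧
      5 / 12 * (F \ kneserStar n r x).card * (n - 1).choose (r - 1) ≤ ((kneserEdges F).card : ℝ) ∧
      G.IsIndepSet F} ≤ Real.exp (1 - n) := by
  have hn0 : (0 : ℝ) < n := by exact_mod_cast (by omega : 0 < n)
  have hr0 : (0 : ℝ) < r := by exact_mod_cast (by omega : 0 < r)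
  refine (randomKneser_real_exists_far_le hr hn.le p ?_).trans ?_
  · have h3 := three_mul_log_div_le_critExponent hr hn.le
    rw [← Real.exp_log (show (0 : ℝ) < r / n by positivity), ← Real.exp_mul]
    apply Real.exp_le_exp.2
    have : Real.log (r / n) = - Real.log (n / r) := by rw [← Real.log_inv, inv_div]
    rw [this]
    linarith
  · have hVn : ((n : ℝ) - 1) ≤ (n - 1).choose (r - 1) := by
      have := self_le_choose (m := n - 1) (k := r - 1) (by omega) (by omega)
      have h' : ((n - 1 : ℕ) : ℝ) ≤ (n - 1).choose (r - 1) := by exact_mod_cast this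
      rwa [Nat.cast_sub (by omega), Nat.cast_one] at h'
    set V := (n - 1).choose (r - 1)
    have h1 : (r / n : ℝ) ^ (δ * V / 4) ≤ Real.exp (-(4 * V)) := by
      calc _ ≤ Real.exp (-(16 / δ)) ^ (δ * V / 4) :=
            Real.rpow_le_rpow (by positivity) hρ (by positivity)
        _ = _ := by
            rw [← Real.exp_mul]
            congr 1
            field_simp
            ring
    have h2 : (2 * Real.exp 1) ^ V ≤ Real.exp (2 * V) := by
      have : 2 * Real.exp 1 ≤ Real.exp 2 := by
        rw [show (2 : ℝ) = 1 + 1 by norm_num, Real.exp_add]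
        gcongr
        linarith [Real.add_one_le_exp 1]
      calc _ ≤ Real.exp 2 ^ V := by gcongr
        _ = _ := by rw [← Real.exp_nat_mul]; ring_nf
    have h3 : (n : ℝ) ≤ Real.exp V := by linarith [Real.add_one_le_exp (V : ℝ)]
    calc _ ≤ Real.exp V * (Real.exp (2 * V) * Real.exp (-(4 * V))) := by gcongr
      _ = Real.exp (-V) := by rw [← Real.exp_add, ← Real.exp_add]; ring_nf
      _ ≤ _ := Real.exp_le_exp.2 (by linarith)

/-- The choice of `δ` gives `(1 - 3 δ)(1 + ε) = 1 + ε / 2`. Half of the surplus `ε L / 2` absorbs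
the factor `e ^ r` from the binomial coefficient, since `r ≤ ε L / 4`. -/
theorem randomKneser_real_near_bound {n r : ℕ} (hr : 2 ≤ r) (hn : r < n) (p : unitInterval)
    {ε δ : ℝ} (hε : 0 < ε) (hδ : δ = ε / (6 * (1 + ε)))
    (hp : (1 + ε) * critExponent n r ≤ p * (n - 1).choose (r - 1))
    (hρ : (r / n : ℝ) ≤ Real.exp (-(4 / ε)))
    (hW : (r * (n - 2).choose (r - 2) : ℝ) ≤ δ * (n - 1).choose (r - 1))
    (hsmall : δ⁻¹ * (n : ℝ) ^ (-(ε / 4)) ≤ 1) :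
    (randomKneser n r p).real {G | ∃ x, ∃ F : Finset (RSet n r), F.Nonempty ∧
      (∀ A ∈ F, x ∉ A.1) ∧ (F.card : ℝ) ≤ δ * (n - 1).choose (r - 1) ∧
      (starNeighbors G x F).card ≤ F.card} ≤ 2 * (δ⁻¹ * (n : ℝ) ^ (-(ε / 4))) := by
  have hn0 : (0 : ℝ) < n := by exact_mod_cast (by omega : 0 < n)
  have hn1 : (1 : ℝ) ≤ n := by exact_mod_cast (by omega : 1 ≤ n)
  have hr0 : (0 : ℝ) < r := by exact_mod_cast (by omega : 0 < r)
  have hδ0 : 0 < δ := by rw [hδ]; positivity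
  have hδε : 6 * δ * (1 + ε) = ε := by rw [hδ]; field_simp
  have hδ1 : δ ≤ 1 / 6 := by nlinarith
  refine (randomKneser_real_exists_near_le hr p hδ0 (by linarith) hW).trans ?_
  set V := (n - 1).choose (r - 1)
  set L := critExponent n r with hL
  have hL0 : 0 ≤ L := critExponent_nonneg (by omega) hn.le
  set t := n.choose r * (δ⁻¹ * Real.exp (-((1 - 3 * δ) * (p * V)))) with ht
  have ht0 : 0 ≤ t := by positivity
  have hrL : r ≤ ε / 4 * L := by
    have h1 : 4 / ε ≤ Real.log (n / r) := by
      have : Real.log (r / n) ≤ -(4 / ε) := by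
        rw [Real.log_le_iff_le_exp (by positivity)]
        exact hρ
      have h' : Real.log (r / n) = - Real.log (n / r) := by rw [← Real.log_inv, inv_div]
      linarith
    have h2 : r * (4 / ε) ≤ L := by
      rw [hL, critExponent_eq (by omega) hn.le]
      have := mul_le_mul_of_nonneg_left h1 hr0.le
      linarith [Real.log_natCast_nonneg n]
    calc (r : ℝ) = ε / 4 * (r * (4 / ε)) := by field_simp
      _ ≤ _ := by gcongr
  have hnt : n * t ≤ δ⁻¹ * (n : ℝ) ^ (-(ε / 4)) := by
    have h1 : n * (n.choose r : ℝ) ≤ Real.exp (L + r) := by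
      rw [Real.exp_add, exp_critExponent (by omega) hn.le]
      have := choose_le_div_pow_mul_exp (n := n) (by omega : 1 ≤ r)
      calc _ ≤ n * ((n / r : ℝ) ^ r * Real.exp r) := by gcongr
        _ = _ := by ring
    have h2 : (1 + ε / 2) * L ≤ (1 - 3 * δ) * (p * V) := by
      calc (1 + ε / 2) * L = (1 - 3 * δ) * ((1 + ε) * L) := by linear_combination (L / 2) * hδε
        _ ≤ _ := mul_le_mul_of_nonneg_left hp (by linarith)
    calc n * t = δ⁻¹ * (n * (n.choose r : ℝ) * Real.exp (-((1 - 3 * δ) * (p * V)))) := by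
          rw [ht]; ring
      _ ≤ δ⁻¹ * (Real.exp (L + r) * Real.exp (-((1 + ε / 2) * L))) := by gcongr
      _ ≤ δ⁻¹ * (n : ℝ) ^ (-(ε / 4)) := by
          rw [← Real.exp_add, Real.rpow_def_of_pos hn0]
          gcongr
          have h3 := log_le_critExponent (by omega : 1 ≤ r) hn.le
          have h4 := mul_le_mul_of_nonneg_left h3 (by positivity : 0 ≤ ε / 4)
          rw [← hL] at h4
          linarith
  have ht1 : t ≤ 1 := by nlinarith
  have h5 := Real.abs_exp_sub_one_le (x := t) (by rwa [abs_of_nonneg ht0])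
  rw [abs_of_nonneg ht0] at h5
  have h6 := (le_abs_self _).trans h5
  nlinarith

theorem randomKneser_real_stars_ge {n r K : ℕ} (hr : 2 ≤ r) (p : unitInterval)
    {ε δ : ℝ} (hε : 0 < ε) (hδ : δ = ε / (6 * (1 + ε))) (hK : 24 ≤ δ * K)
    (hp : (1 + ε) * pCrit n r ≤ p) (hrn : 12 / δ * K ^ 2 * r ^ 3 ≤ (n : ℝ))
    (hρ : (r / n : ℝ) ≤ Real.exp (-(16 / δ)))
    (hsmall : δ⁻¹ * (n : ℝ) ^ (-(ε / 4)) ≤ 1) :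
    (n - 2).choose (r - 2) + 1 < (n - 1).choose (r - 1) ∧ 0 < n ∧
    1 - (Real.exp (1 - n) + 2 * (δ⁻¹ * (n : ℝ) ^ (-(ε / 4)))) ≤
      (randomKneser n r p).real {G | ∀ 𝒜 : Finset (RSet n r),
        G.IsNIndepSet ((n - 1).choose (r - 1)) 𝒜 ↔ ∃ x, 𝒜 = kneserStar n r x} := by
  classical
  have hr2 : (2 : ℝ) ≤ r := by exact_mod_cast hr
  have hδ0 : 0 < δ := by rw [hδ]; positivity
  have hδε : 6 * δ * (1 + ε) = ε := by rw [hδ]; field_simp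
  have hδ1 : δ ≤ 1 / 6 := by nlinarith
  have hK144 : (144 : ℝ) ≤ K := by nlinarith [(Nat.cast_nonneg K : (0 : ℝ) ≤ K)]
  have hK0 : 0 < K := by exact_mod_cast (by linarith : (0 : ℝ) < K)
  have hrn' : 12 * (K ^ 2 * r ^ 3) ≤ δ * (n : ℝ) := by
    calc 12 * ((K : ℝ) ^ 2 * r ^ 3) = δ * (12 / δ * K ^ 2 * r ^ 3) := by field_simp
      _ ≤ _ := by gcongr
  have hK2 : (1 : ℝ) ≤ K ^ 2 := by nlinarith
  have hr3 : (r : ℝ) ^ 3 ≤ K ^ 2 * r ^ 3 := le_mul_of_one_le_left (by positivity) hK2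
  have hr23 : (r : ℝ) ^ 2 ≤ r ^ 3 := pow_le_pow_right₀ (by linarith) (by norm_num)
  have hr2n : (r : ℝ) ^ 2 ≤ δ * n := by nlinarith [sq_nonneg (r : ℝ)]
  have h12 : 12 * (r : ℝ) ≤ n := by nlinarith
  have hn : r < n := by exact_mod_cast (by linarith : (r : ℝ) < n)
  have hn0 : (0 : ℝ) < n := by linarith
  have hWV := mul_choose_sub_two_le hr hn.le
  have hVn : n - 1 ≤ (n - 1).choose (r - 1) :=
    self_le_choose (m := n - 1) (k := r - 1) (by omega) (by omega)
  have hn24 : 24 ≤ n := by exact_mod_cast (by linarith : (24 : ℝ) ≤ n)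
  have hV1 : (23 : ℝ) ≤ (n - 1).choose (r - 1) := by
    exact_mod_cast (by omega : 23 ≤ (n - 1).choose (r - 1))
  have hpC : (1 + ε) * critExponent n r ≤ p * (n - 1).choose (r - 1) := by
    have h : pCrit n r = critExponent n r / (n - 1).choose (r - 1) := rfl
    rw [h, ← mul_div_assoc, div_le_iff₀ (by linarith)] at hp
    exact hp
  have hL0 : 0 ≤ critExponent n r := critExponent_nonneg (by omega) hn.le
  have hW : (r * (n - 2).choose (r - 2) : ℝ) ≤ δ * (n - 1).choose (r - 1) := by
    have : n * (r * (n - 2).choose (r - 2) : ℝ) ≤ n * (δ * (n - 1).choose (r - 1)) := by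
      calc _ = r * (n * (n - 2).choose (r - 2) : ℝ) := by ring
        _ ≤ r * (r * (n - 1).choose (r - 1)) := by gcongr
        _ = r ^ 2 * (n - 1).choose (r - 1) := by ring
        _ ≤ (δ * n) * (n - 1).choose (r - 1) := by gcongr
        _ = _ := by ring
    exact le_of_mul_le_mul_left this hn0
  -- The cubic growth condition enters here: `W ≤ (r / n) V`, so the left side is at most `K² r³ V /
  -- n`.
  have hKW : ((K * r : ℕ) : ℝ) ^ 2 * (n - 2).choose (r - 2) ≤ δ / 12 * (n - 1).choose (r - 1) := by
    have : n * (((K * r : ℕ) : ℝ) ^ 2 * (n - 2).choose (r - 2)) ≤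
        n * (δ / 12 * (n - 1).choose (r - 1)) := by
      push_cast
      calc _ = (K * r : ℝ) ^ 2 * (n * (n - 2).choose (r - 2)) := by ring
        _ ≤ (K * r : ℝ) ^ 2 * (r * (n - 1).choose (r - 1)) := by gcongr
        _ = (12 * (K ^ 2 * r ^ 3)) * ((n - 1).choose (r - 1) / 12) := by ring
        _ ≤ (δ * n) * ((n - 1).choose (r - 1) / 12) := by gcongr
        _ = _ := by ring
    exact le_of_mul_le_mul_left this hn0
  refine ⟨?_, by omega, ?_⟩
  · have h1 : ((n - 2).choose (r - 2) : ℝ) + 1 < (n - 1).choose (r - 1) := by nlinarith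
    exact_mod_cast h1
  have hfar := randomKneser_real_far_bound hr hn p hδ0 (by nlinarith) hρ
  have hρ' : (r / n : ℝ) ≤ Real.exp (-(4 / ε)) := by
    refine hρ.trans (Real.exp_le_exp.2 (neg_le_neg ?_))
    apply div_le_div₀ (by norm_num) (by norm_num) hδ0
    nlinarith
  have hnear := randomKneser_real_near_bound hr hn p hε hδ hpC hρ' hW hsmall
  set far := {G : SimpleGraph (RSet n r) | ∃ x, ∃ F : Finset (RSet n r),
      δ * (n - 1).choose (r - 1) ≤ (F \ kneserStar n r x).card ∧
      5 / 12 * (F \ kneserStar n r x).card * (n - 1).choose (r - 1) ≤ ((kneserEdges F).card : ℝ) ∧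
      G.IsIndepSet F} with hfar_def
  set near := {G : SimpleGraph (RSet n r) | ∃ x, ∃ F : Finset (RSet n r), F.Nonempty ∧
      (∀ A ∈ F, x ∉ A.1) ∧ (F.card : ℝ) ≤ δ * (n - 1).choose (r - 1) ∧
      (starNeighbors G x F).card ≤ F.card} with hnear_def
  set good := {G : SimpleGraph (RSet n r) | ∀ 𝒜 : Finset (RSet n r),
        G.IsNIndepSet ((n - 1).choose (r - 1)) 𝒜 ↔ ∃ x, 𝒜 = kneserStar n r x} with hgood
  -- Almost surely the graph lies in the Kneser graph, so stars are independent and failure means a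
  -- non-star independent set of size `V`.
  have hcover : (randomKneser n r p).real Set.univ ≤
      (randomKneser n r p).real (good ∪ (far ∪ near)) := by
    refine ENNReal.toReal_mono (measure_ne_top _ _) (measure_mono_ae ?_)
    filter_upwards [randomSubgraph_ae_le (kneserGraph n r) p] with G hG _
    by_cases hg : G ∈ good
    · exact Or.inl hg
    right
    rw [hgood, Set.mem_ofPred_eq, not_forall] at hg
    obtain ⟨F, hF⟩ := hg
    have hF' : G.IsNIndepSet ((n - 1).choose (r - 1)) F ∧ ¬ ∃ x, F = kneserStar n r x := by
      by_contra hcon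
      apply hF
      constructor
      · intro h
        by_contra h'
        exact hcon ⟨h, h'⟩
      · rintro ⟨x, rfl⟩
        exact ⟨isIndepSet_kneserStar hG x, card_kneserStar (by omega) x⟩
    obtain ⟨x, hmax, hne, hnb⟩ := exists_star_of_isNIndepSet (by omega) (by omega) hF'.1
      (fun x hx => hF'.2 ⟨x, hx⟩)
    rcases le_total (δ * (n - 1).choose (r - 1)) ((F \ kneserStar n r x).card : ℝ) with h | h
    · left
      exact ⟨x, F, h, card_sdiff_kneserStar_mul_le_card_kneserEdges hr hK0 hδ0.le hF'.1.card_eq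
        hmax h hKW hK, hF'.1.isIndepSet⟩
    · right
      refine ⟨x, F \ kneserStar n r x, hne, fun A hA => ?_, h, hnb⟩
      simpa using (Finset.mem_sdiff.1 hA).2
  have h1 := measureReal_union_le (μ := randomKneser n r p) good (far ∪ near)
  have h2 := measureReal_union_le (μ := randomKneser n r p) far near
  rw [probReal_univ] at hcover
  linarith

/-- The expected number of pairs is at least `exp(L) / 2 * exp(-(1 - ε / 2) L) ≥ n ^ (ε / 2) / 2`;
half of `ε` pays for replacing `1 - p` by an exponential. Also `p W ≤ (r / n) p V ≤ t`. -/
theorem randomKneser_real_indepNum_eq_le_of_le_pCrit {n r : ℕ} (hr : 2 ≤ r) (p : unitInterval)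
    {ε t : ℝ} (hε : 0 < ε) (hε1 : ε ≤ 1) (hp : p ≤ (1 - ε) * pCrit n r) (hrn : 2 * r ≤ n)
    (ht : 2 * r ^ 2 / n * Real.log n ≤ t) (htε : t ≤ ε / 2) :
    (randomKneser n r p).real {G | G.indepNum = (n - 1).choose (r - 1)} ≤
      2 * (n : ℝ) ^ (-(ε / 2)) + ((1 - t)⁻¹ - 1) := by
  have hn : r < n := by omega
  have hr2 : (2 : ℝ) ≤ r := by exact_mod_cast hr
  have hrn' : (2 * r : ℝ) ≤ n := by exact_mod_cast hrn
  have hn0 : (0 : ℝ) < n := by linarith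
  have hWV := mul_choose_sub_two_le hr hn.le
  have hW1 : (1 : ℝ) ≤ (n - 2).choose (r - 2) := by
    exact_mod_cast Nat.choose_pos (by omega : r - 2 ≤ n - 2)
  have hV0 : (0 : ℝ) < (n - 1).choose (r - 1) := by
    exact_mod_cast Nat.choose_pos (by omega : r - 1 ≤ n - 1)
  have hp0 := p.2.1
  set L := critExponent n r with hL
  have hL0 : 0 ≤ L := critExponent_nonneg (by omega) hn.le
  have hpV : (p : ℝ) * (n - 1).choose (r - 1) ≤ (1 - ε) * L := by
    have h : pCrit n r = L / (n - 1).choose (r - 1) := rfl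
    rw [h, ← mul_div_assoc, le_div_iff₀ hV0] at hp
    exact hp
  have hpW : (p : ℝ) * (n - 2).choose (r - 2) ≤ t := by
    refine le_trans ?_ ht
    have hLle : L ≤ 2 * r * Real.log n := by
      rw [hL, critExponent]
      have h1 := Real.log_natCast_nonneg r
      have h2 := Real.log_natCast_nonneg n
      nlinarith
    have h1 : n * (p * (n - 2).choose (r - 2) : ℝ) ≤ n * (2 * r ^ 2 / n * Real.log n) := by
      calc _ = p * (n * (n - 2).choose (r - 2) : ℝ) := by ring
        _ ≤ p * (r * (n - 1).choose (r - 1)) := by gcongr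
        _ = r * (p * (n - 1).choose (r - 1)) := by ring
        _ ≤ r * ((1 - ε) * L) := by gcongr
        _ ≤ r * (1 * L) := by gcongr; linarith
        _ ≤ r * (2 * r * Real.log n) := by rw [one_mul]; gcongr
        _ = _ := by field_simp
    exact le_of_mul_le_mul_left h1 hn0
  have hpt : (p : ℝ) ≤ t := (le_mul_of_one_le_right hp0 hW1).trans hpW
  refine (randomKneser_real_indepNum_eq_le hr hn p (by linarith)).trans ?_
  set V := (n - 1).choose (r - 1)
  have hq0 : (0 : ℝ) < 1 - p := by linarith
  have hpow : Real.exp (-((1 - ε / 2) * L)) ≤ (1 - p : ℝ) ^ V := by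
    have h1 : -(p / (1 - p) : ℝ) ≤ Real.log (1 - p) := by
      have := Real.one_sub_inv_le_log_of_pos hq0
      refine le_trans (le_of_eq ?_) this
      field_simp
      ring
    have h2 : (p / (1 - p) : ℝ) * V ≤ (1 - ε / 2) * L := by
      rw [div_mul_eq_mul_div, div_le_iff₀ hq0]
      have h3 : (1 - ε) ≤ (1 - ε / 2) * (1 - p) := by nlinarith
      calc _ ≤ (1 - ε) * L := hpV
        _ ≤ ((1 - ε / 2) * (1 - p)) * L := by gcongr
        _ = _ := by ring
    rw [← Real.exp_log hq0, ← Real.exp_nat_mul]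
    apply Real.exp_le_exp.2
    have := mul_le_mul_of_nonneg_left h1 (Nat.cast_nonneg (α := ℝ) V)
    linarith
  have hcount : Real.exp L / 2 ≤ (n.choose r * (n - r : ℕ) : ℝ) := by
    rw [hL, exp_critExponent (by omega) hn.le, Nat.cast_sub hn.le]
    have := div_pow_le_choose (by omega : 1 ≤ r) hn.le
    calc _ = (n / r : ℝ) ^ r * (n / 2) := by ring
      _ ≤ _ := by gcongr; linarith
  have hE : (n : ℝ) ^ (ε / 2) / 2 ≤ (n.choose r * (n - r : ℕ) : ℝ) * (1 - p) ^ V := by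
    calc (n : ℝ) ^ (ε / 2) / 2 ≤ Real.exp (ε / 2 * L) / 2 := by
          rw [Real.rpow_def_of_pos hn0, mul_comm (Real.log n)]
          gcongr
          exact log_le_critExponent (by omega) hn.le
      _ = Real.exp L / 2 * Real.exp (-((1 - ε / 2) * L)) := by
          rw [div_mul_eq_mul_div (Real.exp L), ← Real.exp_add]
          ring_nf
      _ ≤ _ := by gcongr
  have hinv : ((n.choose r * (n - r : ℕ) : ℝ) * (1 - p) ^ V)⁻¹ ≤ 2 * (n : ℝ) ^ (-(ε / 2)) := by
    refine (inv_anti₀ (by positivity) hE).trans (le_of_eq ?_)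
    rw [Real.rpow_neg hn0.le, inv_div, div_eq_mul_inv]
  gcongr
  linarith

/-! ### Passage to the limit -/

theorem eventually_mul_cube_le {r : ℕ → ℕ}
    (hr : (fun n : ℕ => (r n : ℝ)) =o[atTop] fun n : ℕ => (n : ℝ) ^ (1 / 3 : ℝ)) {C : ℝ}
    (hC : 0 < C) : ∀ᶠ n in atTop, C * (r n : ℝ) ^ 3 ≤ n := by
  have hc : (0 : ℝ) < C⁻¹ ^ (1 / 3 : ℝ) := by positivity
  filter_upwards [hr.bound hc] with n hn
  rw [Real.norm_of_nonneg (by positivity), Real.norm_of_nonneg (by positivity)] at hn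
  have h1 : (r n : ℝ) ^ 3 ≤ (C⁻¹ ^ (1 / 3 : ℝ) * (n : ℝ) ^ (1 / 3 : ℝ)) ^ 3 := by gcongr
  have h2 : ∀ a : ℝ, 0 ≤ a → (a ^ (1 / 3 : ℝ)) ^ 3 = a := by
    intro a ha
    rw [← Real.rpow_natCast, ← Real.rpow_mul ha]
    norm_num
  rw [mul_pow, h2 _ (by positivity), h2 _ (by positivity)] at h1
  calc C * (r n : ℝ) ^ 3 ≤ C * (C⁻¹ * n) := by gcongr
    _ = n := by field_simp

theorem eventually_div_le {r : ℕ → ℕ} (hr2 : ∀ᶠ n in atTop, 2 ≤ r n)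
    (hr : (fun n : ℕ => (r n : ℝ)) =o[atTop] fun n : ℕ => (n : ℝ) ^ (1 / 3 : ℝ)) {c : ℝ}
    (hc : 0 < c) : ∀ᶠ n in atTop, (r n / n : ℝ) ≤ c := by
  filter_upwards [hr2, eventually_mul_cube_le hr (inv_pos.2 hc), eventually_gt_atTop 0]
    with n h2 h3 hn
  have hn0 : (0 : ℝ) < n := by exact_mod_cast hn
  have h2' : (1 : ℝ) ≤ r n := by exact_mod_cast (by omega : 1 ≤ r n)
  have h4 : (r n : ℝ) ≤ r n ^ 3 := le_self_pow₀ h2' (by norm_num)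
  rw [div_le_iff₀ hn0]
  calc (r n : ℝ) ≤ r n ^ 3 := h4
    _ = c * (c⁻¹ * r n ^ 3) := by field_simp
    _ ≤ c * n := by gcongr

theorem tendsto_natCast_rpow_neg {a : ℝ} (ha : 0 < a) :
    Tendsto (fun n : ℕ => (n : ℝ) ^ (-a)) atTop (𝓝 0) :=
  (tendsto_rpow_neg_atTop ha).comp tendsto_natCast_atTop_atTop

theorem tendsto_randomKneser_stars {ε : ℝ} (hε : 0 < ε) {r : ℕ → ℕ} (hr2 : ∀ᶠ n in atTop, 2 ≤ r n)
    (hr : (fun n : ℕ => (r n : ℝ)) =o[atTop] fun n : ℕ => (n : ℝ) ^ (1 / 3 : ℝ))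
    {p : ℕ → unitInterval} (hp : ∀ᶠ n in atTop, (1 + ε) * pCrit n (r n) ≤ (p n : ℝ)) :
    Tendsto (fun n => (randomKneser n (r n) (p n)).real
          {G | G.indepNum = (n - 1).choose (r n - 1)}) atTop (𝓝 1) ∧
      Tendsto (fun n => (randomKneser n (r n) (p n)).real
          {G | ∀ 𝒜 : Finset (RSet n (r n)),
            G.IsNIndepSet ((n - 1).choose (r n - 1)) 𝒜 ↔ ∃ x, 𝒜 = kneserStar n (r n) x})
        atTop (𝓝 1) := by
  obtain ⟨δ, hδ⟩ : ∃ δ, δ = ε / (6 * (1 + ε)) := ⟨_, rfl⟩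
  have hδ0 : 0 < δ := by rw [hδ]; positivity
  obtain ⟨K, hK⟩ := exists_nat_ge (24 / δ)
  have hK' : 24 ≤ δ * K := by rwa [div_le_iff₀' hδ0] at hK
  have hK0 : (0 : ℝ) < K := by
    have : 0 < 24 / δ := by positivity
    linarith
  have htend : Tendsto (fun n : ℕ => δ⁻¹ * (n : ℝ) ^ (-(ε / 4))) atTop (𝓝 0) := by
    simpa using (tendsto_natCast_rpow_neg (by positivity : 0 < ε / 4)).const_mul δ⁻¹
  have hexp : Tendsto (fun n : ℕ => Real.exp (1 - (n : ℝ))) atTop (𝓝 0) :=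
    Real.tendsto_exp_atBot.comp
      (tendsto_atBot_add_const_left _ 1 (tendsto_neg_atTop_atBot.comp tendsto_natCast_atTop_atTop))
  have hlow : Tendsto (fun n : ℕ => 1 - (Real.exp (1 - (n : ℝ)) +
      2 * (δ⁻¹ * (n : ℝ) ^ (-(ε / 4))))) atTop (𝓝 1) := by
    simpa using (hexp.add (htend.const_mul 2)).const_sub 1
  have hev : ∀ᶠ n : ℕ in atTop, (n - 2).choose (r n - 2) + 1 < (n - 1).choose (r n - 1) ∧ 0 < n ∧
      1 - (Real.exp (1 - (n : ℝ)) + 2 * (δ⁻¹ * (n : ℝ) ^ (-(ε / 4)))) ≤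
      (randomKneser n (r n) (p n)).real {G | ∀ 𝒜 : Finset (RSet n (r n)),
        G.IsNIndepSet ((n - 1).choose (r n - 1)) 𝒜 ↔ ∃ x, 𝒜 = kneserStar n (r n) x} := by
    filter_upwards [hr2, hp, eventually_mul_cube_le hr (by positivity : 0 < 12 / δ * (K : ℝ) ^ 2),
      eventually_div_le hr2 hr (Real.exp_pos (-(16 / δ))), htend.eventually_le_const one_pos]
      with n h1 h2 h3 h4 h5
    exact randomKneser_real_stars_ge h1 (p n) hε hδ hK' h2 h3 h4 h5
  constructor
  · refine tendsto_of_tendsto_of_tendsto_of_le_of_le' hlow tendsto_const_nhds ?_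
      (Eventually.of_forall fun n => measureReal_le_one)
    filter_upwards [hev, hr2] with n ⟨hW, hn, h⟩ h2
    exact h.trans (measureReal_mono
      (fun G hG => indepNum_eq_of_forall_isNIndepSet_iff hn h2 hW hG) (measure_ne_top _ _))
  · refine tendsto_of_tendsto_of_tendsto_of_le_of_le' hlow tendsto_const_nhds ?_
      (Eventually.of_forall fun n => measureReal_le_one)
    filter_upwards [hev] with n h using h.2.2

theorem tendsto_randomKneser_indepNum_eq_zero {ε : ℝ} (hε : 0 < ε) (hε1 : ε ≤ 1) {r : ℕ → ℕ}
    (hr2 : ∀ᶠ n in atTop, 2 ≤ r n)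
    (hr : (fun n : ℕ => (r n : ℝ)) =o[atTop] fun n : ℕ => (n : ℝ) ^ (1 / 3 : ℝ))
    {p : ℕ → unitInterval} (hp : ∀ᶠ n in atTop, (p n : ℝ) ≤ (1 - ε) * pCrit n (r n)) :
    Tendsto (fun n => (randomKneser n (r n) (p n)).real
          {G | G.indepNum = (n - 1).choose (r n - 1)}) atTop (𝓝 0) := by
  -- Since eventually `r ≤ n ^ (1/3)`, this dominates `2 r² log n / n`.
  set t : ℕ → ℝ := fun n => 2 * (Real.log n / (n : ℝ) ^ (1 / 3 : ℝ)) with ht_def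
  have ht : Tendsto t atTop (𝓝 0) := by
    have h := ((isLittleO_log_rpow_atTop (by norm_num : (0 : ℝ) < 1 / 3)).tendsto_div_nhds_zero).comp
      tendsto_natCast_atTop_atTop
    simpa [ht_def] using h.const_mul 2
  have hup : Tendsto (fun n : ℕ => 2 * (n : ℝ) ^ (-(ε / 2)) + ((1 - t n)⁻¹ - 1)) atTop (𝓝 0) := by
    have h1 := (tendsto_natCast_rpow_neg (by positivity : 0 < ε / 2)).const_mul 2
    have h2 := ((ht.const_sub 1).inv₀ (by norm_num)).sub_const 1
    simpa using h1.add h2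
  refine tendsto_of_tendsto_of_tendsto_of_le_of_le' tendsto_const_nhds hup
    (Eventually.of_forall fun n => measureReal_nonneg) ?_
  filter_upwards [hr2, hp, hr.bound one_pos, eventually_div_le hr2 hr (by norm_num : (0 : ℝ) < 1 / 2),
    ht.eventually_le_const (by positivity : 0 < ε / 2), eventually_gt_atTop 0]
    with n h1 h2 h3 h4 h5 hn
  have hn0 : (0 : ℝ) < n := by exact_mod_cast hn
  rw [Real.norm_of_nonneg (by positivity), Real.norm_of_nonneg (by positivity), one_mul] at h3
  have h4' : 2 * r n ≤ n := by
    rw [div_le_iff₀ hn0] at h4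
    exact_mod_cast (by linarith : (2 * r n : ℝ) ≤ n)
  refine randomKneser_real_indepNum_eq_le_of_le_pCrit h1 (p n) hε hε1 h2 h4' ?_ h5
  have hlog := Real.log_natCast_nonneg n
  have h6 : (2 * r n ^ 2 / n : ℝ) ≤ 2 / (n : ℝ) ^ (1 / 3 : ℝ) := by
    rw [div_le_div_iff₀ hn0 (by positivity)]
    calc (2 * r n ^ 2 * (n : ℝ) ^ (1 / 3 : ℝ) : ℝ)
        ≤ 2 * ((n : ℝ) ^ (1 / 3 : ℝ)) ^ 2 * (n : ℝ) ^ (1 / 3 : ℝ) := by gcongr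
      _ = 2 * ((n : ℝ) ^ (1 / 3 : ℝ)) ^ 3 := by ring
      _ = 2 * n := by
          rw [← Real.rpow_natCast, ← Real.rpow_mul hn0.le]
          norm_num
  calc _ ≤ 2 / (n : ℝ) ^ (1 / 3 : ℝ) * Real.log n := by gcongr
    _ = t n := by rw [ht_def]; ring

theorem theorem1 (ε : ℝ) (hε : 0 < ε) (r : ℕ → ℕ) (hr2 : ∀ᶠ n in atTop, 2 ≤ r n)
    (hr : (fun n : ℕ => (r n : ℝ)) =o[atTop] fun n : ℕ => (n : ℝ) ^ (1 / 3 : ℝ))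
    (p : ℕ → unitInterval) :
    ((∀ᶠ n in atTop, (1 + ε) * pCrit n (r n) ≤ (p n : ℝ)) →
      Tendsto (fun n => (randomKneser n (r n) (p n)).real
          {G | G.indepNum = (n - 1).choose (r n - 1)}) atTop (𝓝 1) ∧
      Tendsto (fun n => (randomKneser n (r n) (p n)).real
          {G | ∀ 𝒜 : Finset (RSet n (r n)),
            G.IsNIndepSet ((n - 1).choose (r n - 1)) 𝒜 ↔ ∃ x, 𝒜 = kneserStar n (r n) x})
        atTop (𝓝 1)) ∧
    ((∀ᶠ n in atTop, (p n : ℝ) ≤ (1 - ε) * pCrit n (r n)) →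
      Tendsto (fun n => (randomKneser n (r n) (p n)).real
          {G | G.indepNum = (n - 1).choose (r n - 1)}) atTop (𝓝 0)) := by
  refine ⟨fun hp => tendsto_randomKneser_stars hε hr2 hr hp, fun hp => ?_⟩
  -- Lowering `ε` to at most `1` only weakens the bound on `p`, because `pCrit` is nonnegative once
  -- `r ≤ n`.
  refine tendsto_randomKneser_indepNum_eq_zero (ε := min ε 1) (by positivity) (min_le_right _ _)
    hr2 hr ?_
  filter_upwards [hp, hr2, eventually_div_le hr2 hr one_pos, eventually_gt_atTop 0]
    with n h1 h2 h3 hn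
  have hn0 : (0 : ℝ) < n := by exact_mod_cast hn
  have hrn : r n ≤ n := by
    rw [div_le_one hn0] at h3
    exact_mod_cast h3
  have hpc : 0 ≤ pCrit n (r n) :=
    div_nonneg (critExponent_nonneg (by omega) hrn) (Nat.cast_nonneg _)
  refine h1.trans (mul_le_mul_of_nonneg_right ?_ hpc)
  linarith [min_le_left ε 1]
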